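/- Corollary 4.9. For $g\in L^1(\mathbb R)\cap L^2(\mathbb R)$ let $[\mathcal Fg](t)=(2\pi)^{-1/2}\int e^{-itx}g(x)\,dx$, extended to $L^2(\mathbb R)$ by Plancherel's theorem, and let $\|g\|_s^2=\int(1+t^2)^s|[\mathcal Fg](t)|^2\,dt\in[0,\infty]$ for $g\in L^2(\mathbb R)$. Let $\mathcal D$ be the set of probability densities on $\mathbb R$ that belong to $L^2(\mathbb R)$, and for $\rho>0$ let $H_p^\rho=\{f\in\mathcal D:\|f\|_p^2\le\rho\}$. For $a,d>0$ let $\mathcal D_{a,d}$ be the set of all $f\in\mathcal D$ with $$d\le(1+t^2)^a\,\bigl|\ln(|[\mathcal Ff](t)|^2)\bigr|^{-1}\le d^{-1}\quad\text{for all }t\in\mathbb R,$$ and let $\mathcal D_a=\bigcup_{d>0}\mathcal D_{a,d}$ be the set of supersmooth densities with parameter $a$. One observes $Y_1,\dots,Y_n$ i.i.d. with density $f_Y(y)=\int f_X(x)f_\epsilon(y-x)\,dx$ and, independently of them, $\epsilon_1,\dots,\epsilon_m$ i.i.d. with density $f_\epsilon$, where $f_X,f_\epsilon\in\mathcal D$.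 An estimator $\widehat f_X$ is a measurable function of the $n+m$ observations with values in $L^2(\mathbb R)$. Let $a>0$, $0\le s<p$ and $\rho>0$. Then there is a constant $C>0$, which does not depend on $n$ and $m$, such that for all $n,m\ge 2$ $$\inf_{\widehat f_X}\ \sup_{f_X\in H_p^\rho,\ f_\epsilon\in\mathcal D_a}\mathbb E\|\widehat f_X-f_X\|_s^2\ \ge\ C\bigl\{(\log n)^{-(p-s)/a}+(\log m)^{-(p-s)/a}\bigr\}.$$ The same holds when the constant in the supersmoothness condition is held fixed: if $0<d<d'$ and $\mathcal D_{a,d'}\neq\emptyset$, then there is $C>0$, which does not depend on $n$ and $m$, such that for all $n,m\ge2$ the bound holds with $\mathcal D_{a,d}$ in place of $\mathcal D_a$. -/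

import Mathlib

open MeasureTheory
open scoped FourierTransform ENNReal

noncomputable section

namespace Deconvolution

/-- A probability density on the real line that belongs to `L²(ℝ)`. -/
structure L2Density where
  toFun : ℝ → ℝ
  nonneg : ∀ x, 0 ≤ toFun x
  integrable : Integrable toFun volume
  integral_eq_one : ∫ x, toFun x = 1
  memLp : MemLp toFun 2 volume

/-- The element of `L²(ℝ)` represented by a density. -/
def L2Density.toL2 (f : L2Density) : Lp ℂ 2 (volume : Measure ℝ) :=
  (f.memLp.ofReal (K := ℂ)).toLp (fun x => (f.toFun x : ℂ))

/-- The unitary Fourier transform `(2π)^{-1/2} ∫ exp(-itx) g(x) dx` of an integrable function,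
defined at every point `t`. -/
def fourierInt (g : ℝ → ℝ) (t : ℝ) : ℂ :=
  ((Real.sqrt (2 * Real.pi))⁻¹ : ℝ) * ∫ x : ℝ, Complex.exp (-(Complex.I * t * x)) * (g x : ℂ)

/-- The same Fourier transform on `L²(ℝ)`, as a function defined almost everywhere. The Plancherel
transform `𝓕` extends `ξ ↦ ∫ exp(-2πixξ) g(x) dx`, which explains the rescaling. -/
def fourierL2 (g : Lp ℂ 2 (volume : Measure ℝ)) (t : ℝ) : ℂ :=
  ((Real.sqrt (2 * Real.pi))⁻¹ : ℝ) * (𝓕 g : Lp ℂ 2 (volume : Measure ℝ)) (t / (2 * Real.pi))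

/-- The squared Sobolev norm `‖g‖_s² = ∫ (1 + t²)^s |F g (t)|² dt`, with values in `[0, ∞]`;
it is finite exactly for `g` in the Sobolev space `H_s`. -/
def sobolevSq (s : ℝ) (g : Lp ℂ 2 (volume : Measure ℝ)) : ℝ≥0∞ :=
  ∫⁻ t : ℝ, ENNReal.ofReal ((1 + t ^ 2) ^ s * ‖fourierL2 g t‖ ^ 2)

/-- The densities in the Sobolev class `H_p^ρ = {f : ‖f‖_p² ≤ ρ}`. -/
def sobolevDensities (p ρ : ℝ) : Set L2Density :=
  {f | sobolevSq p f.toL2 ≤ ENNReal.ofReal ρ}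

/-- The densities that are supersmooth with parameter `a` and constant `d`:
`d ≤ (1 + t²)^a |ln |F f (t)|²|⁻¹ ≤ d⁻¹` for all real `t`. -/
def supersmoothWith (a d : ℝ) : Set L2Density :=
  {f | ∀ t : ℝ,
    d ≤ (1 + t ^ 2) ^ a * |Real.log (‖fourierInt f.toFun t‖ ^ 2)|⁻¹ ∧
    (1 + t ^ 2) ^ a * |Real.log (‖fourierInt f.toFun t‖ ^ 2)|⁻¹ ≤ d⁻¹}

/-- The densities that are supersmooth with parameter `a`, for some constant `d > 0`. -/
def supersmooth (a : ℝ) : Set L2Density :=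
  {f | ∃ d : ℝ, 0 < d ∧ f ∈ supersmoothWith a d}

/-- The probability measure with a given Lebesgue density. -/
def law (g : ℝ → ℝ) : Measure ℝ :=
  volume.withDensity (fun x => ENNReal.ofReal (g x))

/-- The convolution `f_Y(y) = ∫ f_X(x) f_ε(y - x) dx`, the density of `Y = X + ε`. -/
def convDensity (fX fε : L2Density) (y : ℝ) : ℝ :=
  ∫ x, fX.toFun x * fε.toFun (y - x)

/-- The joint law of two independent samples: `Y₁, …, Yₙ` i.i.d. from `f_Y = f_X ⋆ f_ε`, and
`ε₁, …, εₘ` i.i.d. from `f_ε`. -/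
def sampleLaw (n m : ℕ) (fX fε : L2Density) : Measure ((Fin n → ℝ) × (Fin m → ℝ)) :=
  (Measure.pi fun _ : Fin n => law (convDensity fX fε)).prod
    (Measure.pi fun _ : Fin m => law fε.toFun)

/-- The `H_s`-risk `E ‖T(Y, ε) - f_X‖_s²` of an `L²(ℝ)`-valued estimator `T`. -/
def risk (n m : ℕ) (s : ℝ) (T : (Fin n → ℝ) × (Fin m → ℝ) → Lp ℂ 2 (volume : Measure ℝ))
    (fX fε : L2Density) : ℝ≥0∞ :=
  ∫⁻ z, sobolevSq s (T z - fX.toL2) ∂(sampleLaw n m fX fε)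

/-- The minimax `H_s`-risk over `f_X ∈ 𝒳` and `f_ε ∈ ℰ`: the infimum runs over all measurable
functions of the two samples with values in `L²(ℝ)`. -/
def minimaxRisk (n m : ℕ) (s : ℝ) (𝒳 ℰ : Set L2Density) : ℝ≥0∞ :=
  ⨅ (T : (Fin n → ℝ) × (Fin m → ℝ) → Lp ℂ 2 (volume : Measure ℝ)) (_ : StronglyMeasurable T),
    ⨆ (fX ∈ 𝒳) (fε ∈ ℰ), risk n m s T fX fε

end Deconvolution

end

/-!
By Le Cam's two-point argument it suffices to find two pairs (signal, noise) whose signals are far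
apart in `H_s` while the two laws of the data share a common part of fixed mass.

For a large frequency `k` take the signals `X ∗ ν₁` and `X ∗ ν₂`, where `X` has characteristic
function of order `k ^ (-p)` near `±k`, and `ν₁`, `ν₂` are perturbations of `dirac 0` whose
characteristic functions differ only near `±k`. Their squared `H_s` distance is of order
`k ^ (-2(p - s))`. Now let a Fejér law `F` with band limit `k / 2` occur as a summand of the noise
with probability `r = 1 - exp (-c k ^ (2a))`. This factor keeps the noise supersmooth, the loss in
the constant being absorbed by the room between `d` and `d'`; and since the characteristic function
of `F` vanishes near `±k`, we have `F ∗ ν₁ = F ∗ ν₂`. Hence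

* if the noise is the same under both hypotheses, each `Y` has the same law under both on an event
  of probability `r`, and the noise sample carries no information: the common mass is at least
  `r ^ n`;
* if the noise is also convolved with `ν₂` and `ν₁` respectively, the law of `Y` is the same under
  both hypotheses, and each noise observation agrees with probability `r`: the common mass is at
  least `r ^ m`.

With `k ^ 2` of order `log (min n m) ^ (1 / a)` the better of these two masses stays above `1 / 2`.

Supersmooth densities exist for every `a > 0`: mix Fejér densities over a random bandwidth `R` such
that `(1 + R²) ^ a - 2` is exponentially distributed.
-/

open MeasureTheory
open scoped Convolution FourierTransform ENNReal

namespace Deconvolution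

instance isProbabilityMeasure_law (f : L2Density) : IsProbabilityMeasure (law f.toFun) := by
  refine ⟨?_⟩
  rw [law, withDensity_apply _ MeasurableSet.univ, Measure.restrict_univ,
    ← ofReal_integral_eq_lintegral_ofReal f.integrable (ae_of_all _ f.nonneg),
    f.integral_eq_one, ENNReal.ofReal_one]

theorem charFun_law (f : L2Density) (t : ℝ) :
    charFun (law f.toFun) t = ∫ x : ℝ, Complex.exp (t * x * Complex.I) * (f.toFun x : ℂ) := by
  rw [charFun_apply_real, law, integral_withDensity_eq_integral_toReal_smul₀
    f.integrable.aemeasurable.ennreal_ofReal (ae_of_all _ fun x => ENNReal.ofReal_lt_top)]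
  congr! 2 with x
  rw [ENNReal.toReal_ofReal (f.nonneg x), Complex.real_smul, mul_comm]

theorem fourierInt_eq_charFun (f : L2Density) (t : ℝ) :
    fourierInt f.toFun t = ((Real.sqrt (2 * Real.pi))⁻¹ : ℝ) * charFun (law f.toFun) (-t) := by
  rw [fourierInt, charFun_law]
  congr! 4 with x
  push_cast
  ring_nf

/-- The tent function of height `1` supported on `[-b, b]`. -/
noncomputable def tent (b t : ℝ) : ℝ := max 0 (1 - |t| / b)

variable {b t : ℝ}

theorem tent_nonneg (b t : ℝ) : 0 ≤ tent b t := le_max_left _ _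

theorem tent_le_one (hb : 0 ≤ b) (t : ℝ) : tent b t ≤ 1 :=
  max_le zero_le_one (sub_le_self _ (by positivity))

theorem tent_neg (b t : ℝ) : tent b (-t) = tent b t := by rw [tent, tent, abs_neg]

theorem tent_eq_zero (hb : 0 < b) (ht : b ≤ |t|) : tent b t = 0 :=
  max_eq_left (by rwa [sub_nonpos, one_le_div hb])

theorem tent_zero_right (b : ℝ) : tent b 0 = 1 := by simp [tent]

theorem half_le_tent (hb : 0 < b) (ht : |t| ≤ b / 2) : 1 / 2 ≤ tent b t := by
  refine le_max_of_le_right ?_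
  have : |t| / b ≤ 1 / 2 := by rw [div_le_iff₀ hb]; linarith
  linarith

theorem continuous_tent (b : ℝ) : Continuous (tent b) := by unfold tent; fun_prop

theorem lintegral_tent_le (hb : 0 < b) : ∫⁻ t, ENNReal.ofReal (tent b t) ≤ ENNReal.ofReal (2 * b) :=
  calc ∫⁻ t, ENNReal.ofReal (tent b t)
      ≤ ∫⁻ t, (Set.Icc (-b) b).indicator 1 t := by
        refine lintegral_mono fun t => ?_
        by_cases ht : t ∈ Set.Icc (-b) b
        · simpa [ht] using tent_le_one hb.le t
        · have : b ≤ |t| := le_of_not_ge fun h => ht (abs_le.1 h)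
          simp [tent_eq_zero hb this]
    _ = ENNReal.ofReal (2 * b) := by
        rw [lintegral_indicator_one measurableSet_Icc, Real.volume_Icc]
        ring_nf

theorem integrable_tent (hb : 0 < b) : Integrable (tent b) := by
  refine ⟨(continuous_tent b).aestronglyMeasurable, ?_⟩
  rw [hasFiniteIntegral_iff_ofReal (ae_of_all _ (tent_nonneg b))]
  exact (lintegral_tent_le hb).trans_lt ENNReal.ofReal_lt_top

theorem sinc_sq_le (x : ℝ) : Real.sinc x ^ 2 ≤ 2 * (1 + x ^ 2)⁻¹ := by
  rw [← div_eq_mul_inv, le_div_iff₀ (by positivity)]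
  have h_one : Real.sinc x ^ 2 ≤ 1 := (sq_le_one_iff_abs_le_one _).2 (Real.abs_sinc_le_one x)
  have h_sin : Real.sinc x ^ 2 * x ^ 2 ≤ 1 := by
    rcases eq_or_ne x 0 with rfl | hx
    · simp
    · rw [Real.sinc_of_ne_zero hx, ← mul_pow, div_mul_cancel₀ _ hx]
      exact Real.sin_sq_le_one x
  linarith

theorem integrable_sinc_sq : Integrable fun x => Real.sinc x ^ 2 :=
  (integrable_inv_one_add_sq.const_mul 2).mono' (by fun_prop)
    (ae_of_all _ fun x => by
      rw [Real.norm_of_nonneg (sq_nonneg _)]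
      exact sinc_sq_le x)

open Complex in
theorem fourier_indicator_Icc (hb : 0 ≤ b) (u : ℝ) :
    𝓕 ((Set.Icc (-(b / 2)) (b / 2)).indicator (1 : ℝ → ℂ)) u = b * Real.sinc (Real.pi * b * u) := by
  have h_interval : 𝓕 ((Set.Icc (-(b / 2)) (b / 2)).indicator (1 : ℝ → ℂ)) u =
      ∫ x in -(b / 2)..b / 2, exp ((x * (-(2 * Real.pi * u)) : ℝ) * I) := by
    rw [intervalIntegral.integral_of_le (by linarith), ← integral_Icc_eq_integral_Ioc,
      ← integral_indicator measurableSet_Icc, Real.fourier_real_eq_integral_exp_smul]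
    congr with x
    by_cases hx : x ∈ Set.Icc (-(b / 2)) (b / 2)
    · simp only [hx, Set.indicator_of_mem, Pi.one_apply, smul_eq_mul, mul_one]
      ring_nf
    · simp only [hx, not_false_eq_true, Set.indicator_of_notMem, smul_zero]
  rcases eq_or_ne u 0 with rfl | hu
  · simp [h_interval]
  · have h_subst := intervalIntegral.smul_integral_comp_mul_right (fun x : ℝ => exp (x * I))
      (a := -(b / 2)) (b := b / 2) (-(2 * Real.pi * u))
    rw [neg_mul, integral_exp_mul_I_eq_sinc, ← h_interval, real_smul,
      show b / 2 * -(2 * Real.pi * u) = -(Real.pi * b * u) by ring, Real.sinc_neg] at h_subst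
    have hc : ((-(2 * Real.pi * u) : ℝ) : ℂ) ≠ 0 := ofReal_ne_zero.2 (by simp [hu])
    refine mul_left_cancel₀ hc (h_subst.trans ?_)
    push_cast
    ring

theorem indicator_Icc_convolution_self (hb : 0 < b) :
    (Set.Icc (-(b / 2)) (b / 2)).indicator (1 : ℝ → ℂ) ⋆[ContinuousLinearMap.mul ℂ ℂ]
      (Set.Icc (-(b / 2)) (b / 2)).indicator 1 = fun t => b * (tent b t : ℂ) := by
  funext t
  set S := Set.Icc (-(b / 2)) (b / 2)
  have h_prod (x : ℝ) : S.indicator (1 : ℝ → ℂ) x * S.indicator 1 (t - x) =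
      (S ∩ Set.Icc (t - b / 2) (t + b / 2)).indicator 1 x := by
    have : t - x ∈ S ↔ x ∈ Set.Icc (t - b / 2) (t + b / 2) := by
      simp only [S, Set.mem_Icc]
      constructor <;> rintro ⟨h₁, h₂⟩ <;> constructor <;> linarith
    rw [Set.inter_indicator_one, Pi.mul_apply]
    simp only [Set.indicator_apply, this, Pi.one_apply]
  have h_length : min (b / 2) (t + b / 2) - max (-(b / 2)) (t - b / 2) = b - |t| := by
    grind
  simp only [convolution, ContinuousLinearMap.mul_apply', h_prod]
  rw [integral_indicator (measurableSet_Icc.inter measurableSet_Icc), Set.Icc_inter_Icc]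
  simp only [Pi.one_apply, setIntegral_const, Real.volume_real_Icc, h_length, tent]
  rw [Complex.real_smul, mul_one, ← Complex.ofReal_mul, mul_max_of_nonneg _ _ hb.le, mul_zero,
    mul_one_sub, mul_div_cancel₀ _ hb.ne', max_comm]

theorem fourier_tent (hb : 0 < b) (u : ℝ) :
    𝓕 (fun t => (tent b t : ℂ)) u = ((b * Real.sinc (Real.pi * b * u) ^ 2 : ℝ) : ℂ) := by
  have h_int : Integrable ((Set.Icc (-(b / 2)) (b / 2)).indicator (1 : ℝ → ℂ)) :=
    (integrable_indicator_iff measurableSet_Icc).2 (integrableOn_const (by simp))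
  have h := Real.fourier_mul_convolution_eq h_int h_int u
  rw [indicator_Icc_convolution_self hb, fourier_indicator_Icc hb.le] at h
  have h_smul : 𝓕 (fun t => b * (tent b t : ℂ)) u = b * 𝓕 (fun t => (tent b t : ℂ)) u := by
    simp_rw [Real.fourier_real_eq_integral_exp_smul, smul_eq_mul, mul_left_comm _ (b : ℂ)]
    rw [integral_const_mul]
  rw [h_smul] at h
  refine mul_left_cancel₀ (Complex.ofReal_ne_zero.2 hb.ne') (h.trans ?_)
  push_cast
  ring

/-- The Fejér kernel with bandwidth `b`, normalised as the probability density with characteristic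
function `tent b`. -/
noncomputable def fejerKernel (b x : ℝ) : ℝ := b / (2 * Real.pi) * Real.sinc (b / 2 * x) ^ 2

theorem integral_exp_mul_fejerKernel (hb : 0 < b) (t : ℝ) :
    ∫ x : ℝ, Complex.exp (t * x * Complex.I) * (fejerKernel b x : ℂ) = tent b t := by
  have h_fourier : 𝓕 (fun t => (tent b t : ℂ)) =
      fun u => ((b * Real.sinc (Real.pi * b * u) ^ 2 : ℝ) : ℂ) := funext (fourier_tent hb)
  have h_inv := congrFun (Continuous.fourierInv_fourier_eq (f := fun t => (tent b t : ℂ))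
    (Complex.continuous_ofReal.comp (continuous_tent b)) (integrable_tent hb).ofReal
    (h_fourier ▸ ((integrable_sinc_sq.comp_mul_left' (by positivity)).const_mul b).ofReal)) t
  have h_subst := Measure.integral_comp_mul_left
    (fun x : ℝ => Complex.exp (t * x * Complex.I) * (fejerKernel b x : ℂ)) (2 * Real.pi)
  rw [abs_of_pos (by positivity), eq_inv_smul_iff₀ (by positivity), ← integral_smul] at h_subst
  rw [← h_subst, ← h_inv, Real.fourierInv_eq', h_fourier]
  congr with x
  have h_arg : b / 2 * (2 * Real.pi * x) = Real.pi * b * x := by ring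
  simp only [fejerKernel, h_arg, Complex.real_smul, smul_eq_mul, Real.inner_apply]
  push_cast
  field_simp

theorem fejerKernel_nonneg (hb : 0 ≤ b) (x : ℝ) : 0 ≤ fejerKernel b x := by
  unfold fejerKernel
  positivity

theorem fejerKernel_le (hb : 0 ≤ b) (x : ℝ) : fejerKernel b x ≤ b := by
  have h_sinc : Real.sinc (b / 2 * x) ^ 2 ≤ 1 :=
    (sq_le_one_iff_abs_le_one _).2 (Real.abs_sinc_le_one _)
  have h_pi : b / (2 * Real.pi) ≤ b := div_le_self hb (by linarith [Real.pi_gt_three])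
  exact (mul_le_of_le_one_right (by positivity) h_sinc).trans h_pi

theorem integrable_fejerKernel (hb : 0 < b) : Integrable (fejerKernel b) :=
  (integrable_sinc_sq.comp_mul_left' (by positivity)).const_mul _

theorem continuous_fejerKernel : Continuous (Function.uncurry fejerKernel) := by
  unfold Function.uncurry fejerKernel
  fun_prop

theorem integral_fejerKernel (hb : 0 < b) : ∫ x, fejerKernel b x = 1 := by
  have h := integral_exp_mul_fejerKernel hb 0
  simp only [Complex.ofReal_zero, zero_mul, Complex.exp_zero, one_mul, tent_zero_right,
    integral_complex_ofReal] at h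
  exact_mod_cast h

theorem memLp_two_of_bounded {f : ℝ → ℝ} (hf : Integrable f) {M : ℝ} (hM : ∀ x, |f x| ≤ M) :
    MemLp f 2 volume := by
  rw [memLp_two_iff_integrable_sq hf.aestronglyMeasurable]
  simp_rw [pow_two]
  exact hf.bdd_mul hf.aestronglyMeasurable (ae_of_all _ hM)

namespace L2Density

/-- The Fejér kernel with bandwidth `b`, as a probability density. -/
noncomputable def fejer (b : ℝ) (hb : 0 < b) : L2Density where
  toFun := fejerKernel b
  nonneg := fejerKernel_nonneg hb.le
  integrable := integrable_fejerKernel hb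
  integral_eq_one := integral_fejerKernel hb
  memLp := memLp_two_of_bounded (integrable_fejerKernel hb) fun x => by
    rw [abs_of_nonneg (fejerKernel_nonneg hb.le x)]
    exact fejerKernel_le hb.le x

theorem charFun_fejer (hb : 0 < b) (t : ℝ) : charFun (law (fejer b hb).toFun) t = tent b t := by
  rw [charFun_law]
  exact integral_exp_mul_fejerKernel hb t

section Mixture

variable {Ω : Type*} [MeasurableSpace Ω] {P : Measure Ω} {g : Ω → L2Density}

theorem integrable_uncurry [IsFiniteMeasure P]
    (hg : AEStronglyMeasurable (fun z : Ω × ℝ => (g z.1).toFun z.2) (P.prod volume)) :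
    Integrable (fun z : Ω × ℝ => (g z.1).toFun z.2) (P.prod volume) := by
  refine (integrable_prod_iff hg).2 ⟨ae_of_all _ fun ω => (g ω).integrable, ?_⟩
  simp only [Real.norm_of_nonneg ((g _).nonneg _), (g _).integral_eq_one, integrable_const]

theorem integrable_uncurry_sq [SFinite P]
    (hg : AEStronglyMeasurable (fun z : Ω × ℝ => (g z.1).toFun z.2) (P.prod volume))
    (hg2 : Integrable (fun ω => ∫ x, (g ω).toFun x ^ 2) P) :
    Integrable (fun z : Ω × ℝ => (g z.1).toFun z.2 ^ 2) (P.prod volume) := by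
  refine (integrable_prod_iff (hg.pow 2)).2 ⟨ae_of_all _ fun ω => (g ω).memLp.integrable_sq, ?_⟩
  simpa only [Pi.pow_apply, norm_pow, Real.norm_of_nonneg ((g _).nonneg _)] using hg2

/-- The mixture `∫ g ω ∂P` of a family of densities. It is square integrable by Jensen's inequality
when the family has `L²`-norms that are square integrable against `P`. -/
noncomputable def mixture (P : Measure Ω) [IsProbabilityMeasure P] (g : Ω → L2Density)
    (hg : AEStronglyMeasurable (fun z : Ω × ℝ => (g z.1).toFun z.2) (P.prod volume))
    (hg2 : Integrable (fun ω => ∫ x, (g ω).toFun x ^ 2) P) : L2Density where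
  toFun x := ∫ ω, (g ω).toFun x ∂P
  nonneg x := integral_nonneg fun ω => (g ω).nonneg x
  integrable := (integrable_uncurry hg).integral_prod_right
  integral_eq_one := by
    rw [← integral_integral_swap (integrable_uncurry hg)]
    simp only [integral_eq_one, integral_const, probReal_univ, smul_eq_mul, mul_one]
  memLp := by
    have h_meas := (integrable_uncurry hg).integral_prod_right.aestronglyMeasurable
    have h_sq := integrable_uncurry_sq hg hg2
    refine (memLp_two_iff_integrable_sq h_meas).2
      (h_sq.integral_prod_right.mono' (h_meas.pow 2) ?_)
    filter_upwards [(integrable_uncurry hg).prod_left_ae, h_sq.prod_left_ae] with x hx hx2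
    rw [Real.norm_of_nonneg (sq_nonneg _)]
    exact (even_two.convexOn_pow).map_integral_le (by fun_prop) isClosed_univ
      (ae_of_all _ fun _ => Set.mem_univ _) hx hx2

theorem charFun_mixture [IsProbabilityMeasure P]
    (hg : AEStronglyMeasurable (fun z : Ω × ℝ => (g z.1).toFun z.2) (P.prod volume))
    (hg2 : Integrable (fun ω => ∫ x, (g ω).toFun x ^ 2) P) (t : ℝ) :
    charFun (law (mixture P g hg hg2).toFun) t = ∫ ω, charFun (law (g ω).toFun) t ∂P := by
  have h_int : Integrable (fun z : Ω × ℝ =>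
      Complex.exp (t * z.2 * Complex.I) * ((g z.1).toFun z.2 : ℂ)) (P.prod volume) := by
    refine (integrable_uncurry hg).ofReal.bdd_mul (c := 1) (by fun_prop) (ae_of_all _ fun z => ?_)
    rw [← Complex.ofReal_mul, Complex.norm_exp_ofReal_mul_I]
  simp_rw [charFun_law]
  rw [integral_integral_swap h_int]
  congr with x
  simp only [mixture]
  rw [integral_const_mul, integral_complex_ofReal]

end Mixture

/-- The density of `Z + y` for `Z` with density `f`. -/
def translate (f : L2Density) (y : ℝ) : L2Density where
  toFun x := f.toFun (x - y)
  nonneg _ := f.nonneg _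
  integrable := f.integrable.comp_sub_right y
  integral_eq_one := by rw [integral_sub_right_eq_self f.toFun, f.integral_eq_one]
  memLp := f.memLp.comp_measurePreserving (measurePreserving_sub_right volume y)

theorem charFun_translate (f : L2Density) (y t : ℝ) :
    charFun (law (f.translate y).toFun) t =
      charFun (law f.toFun) t * Complex.exp (t * y * Complex.I) := by
  rw [charFun_law, charFun_law, ← integral_mul_const, ← integral_sub_right_eq_self
    (fun x : ℝ => Complex.exp (t * x * Complex.I) * f.toFun x * Complex.exp (t * y * Complex.I)) y]
  refine integral_congr_ae (ae_of_all _ fun x => ?_)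
  simp only [translate]
  rw [mul_right_comm (Complex.exp (t * (x - y : ℝ) * Complex.I)), ← Complex.exp_add]
  push_cast
  ring_nf

theorem aestronglyMeasurable_translate (f : L2Density) (ν : Measure ℝ) [SFinite ν] :
    AEStronglyMeasurable (fun z : ℝ × ℝ => (f.translate z.1).toFun z.2) (ν.prod volume) :=
  (f.integrable.aestronglyMeasurable.comp_quasiMeasurePreserving
    (quasiMeasurePreserving_sub_of_right_invariant volume ν)).prod_swap

/-- The density of `Z + Y` for independent `Z` with density `f` and `Y` with law `ν`. -/
noncomputable def conv (f : L2Density) (ν : Measure ℝ) [IsProbabilityMeasure ν] : L2Density :=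
  mixture ν f.translate (f.aestronglyMeasurable_translate ν) <| by
    simp only [translate, integral_sub_right_eq_self (fun x => f.toFun x ^ 2), integrable_const]

theorem law_conv (f : L2Density) (ν : Measure ℝ) [IsProbabilityMeasure ν] :
    law (f.conv ν).toFun = law f.toFun ∗ ν := by
  refine Measure.ext_of_charFun ?_
  funext t
  rw [charFun_conv, conv, charFun_mixture, charFun_apply_real (μ := ν), ← integral_const_mul]
  simp only [charFun_translate]

section Modulation

variable {κ : ℝ}

theorem abs_mul_cos_le_one (hκ : |κ| ≤ 1) (y : ℝ) : |κ * Real.cos y| ≤ 1 := by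
  rw [abs_mul]
  exact mul_le_one₀ hκ (abs_nonneg _) (Real.abs_cos_le_one _)

theorem abs_one_add_mul_cos_le (hκ : |κ| ≤ 1) (y : ℝ) : |1 + κ * Real.cos y| ≤ 2 :=
  (abs_add_le _ _).trans (by rw [abs_one]; linarith [abs_mul_cos_le_one hκ y])

theorem integral_exp_mul_one_add_cos (f : L2Density) (κ k t : ℝ) :
    ∫ x : ℝ, Complex.exp (t * x * Complex.I) * (((1 + κ * Real.cos (k * x)) * f.toFun x : ℝ) : ℂ) =
      charFun (law f.toFun) t +
        κ / 2 * (charFun (law f.toFun) (t - k) + charFun (law f.toFun) (t + k)) := by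
  have h_int (t : ℝ) : Integrable fun x : ℝ => Complex.exp (t * x * Complex.I) * f.toFun x :=
    f.integrable.ofReal.bdd_mul (c := 1) (by fun_prop) <| ae_of_all _ fun x => by
      rw [← Complex.ofReal_mul, Complex.norm_exp_ofReal_mul_I]
  rw [charFun_law, charFun_law, charFun_law, ← integral_add (h_int _) (h_int _),
    ← integral_const_mul, ← integral_add (h_int _) (((h_int _).fun_add (h_int _)).const_mul _)]
  congr with x
  have h_sub : Complex.exp ((t - k : ℝ) * x * Complex.I) =
      Complex.exp (t * x * Complex.I) * Complex.exp (-(k * x) * Complex.I) := by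
    rw [← Complex.exp_add]
    push_cast
    ring_nf
  have h_add : Complex.exp ((t + k : ℝ) * x * Complex.I) =
      Complex.exp (t * x * Complex.I) * Complex.exp (k * x * Complex.I) := by
    rw [← Complex.exp_add]
    push_cast
    ring_nf
  rw [h_sub, h_add]
  push_cast
  rw [Complex.cos]
  ring

/-- The density `x ↦ (1 + κ * cos (k * x)) * f x`, which has total mass one because the
characteristic function of `f` vanishes at the frequencies `±k`. -/
noncomputable def modulate (f : L2Density) (κ k : ℝ) (hκ : |κ| ≤ 1)
    (hk : charFun (law f.toFun) k = 0) : L2Density where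
  toFun x := (1 + κ * Real.cos (k * x)) * f.toFun x
  nonneg x := mul_nonneg (by linarith [(abs_le.1 (abs_mul_cos_le_one hκ (k * x))).1]) (f.nonneg x)
  integrable := f.integrable.bdd_mul (c := 2) (by fun_prop)
    (ae_of_all _ fun x => abs_one_add_mul_cos_le hκ (k * x))
  integral_eq_one := by
    have h := integral_exp_mul_one_add_cos f κ k 0
    simp only [Complex.ofReal_zero, zero_mul, Complex.exp_zero, one_mul, zero_sub, zero_add,
      charFun_neg, hk, charFun_zero, probReal_univ, Complex.ofReal_one, map_zero, add_zero,
      mul_zero, integral_complex_ofReal] at h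
    exact_mod_cast h
  memLp := f.memLp.of_le_mul (c := 2) ((by fun_prop : AEStronglyMeasurable
      (fun x => 1 + κ * Real.cos (k * x)) volume).mul f.memLp.1) <| ae_of_all _ fun x => by
    rw [norm_mul]
    exact mul_le_mul_of_nonneg_right (abs_one_add_mul_cos_le hκ (k * x)) (norm_nonneg _)

theorem charFun_modulate (f : L2Density) {k : ℝ} (hκ : |κ| ≤ 1)
    (hk : charFun (law f.toFun) k = 0) (t : ℝ) :
    charFun (law (f.modulate κ k hκ hk).toFun) t = charFun (law f.toFun) t +
      κ / 2 * (charFun (law f.toFun) (t - k) + charFun (law f.toFun) (t + k)) := by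
  rw [charFun_law]
  exact integral_exp_mul_one_add_cos f κ k t

end Modulation

end L2Density

theorem law_convDensity (fX fε : L2Density) :
    law (convDensity fX fε) = law fX.toFun ∗ law fε.toFun := by
  have h : convDensity fX fε = (fε.conv (law fX.toFun)).toFun := by
    funext y
    change ∫ x, fX.toFun x * fε.toFun (y - x) = ∫ x, fε.toFun (y - x) ∂law fX.toFun
    rw [law, integral_withDensity_eq_integral_toReal_smul₀
      fX.integrable.aemeasurable.ennreal_ofReal (ae_of_all _ fun x => ENNReal.ofReal_lt_top)]
    simp only [ENNReal.toReal_ofReal (fX.nonneg _), smul_eq_mul]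
  rw [h, L2Density.law_conv, Measure.conv_comm]

section Fourier

variable {V E : Type*} [NormedAddCommGroup V] [InnerProductSpace ℝ V] [FiniteDimensional ℝ V]
  [MeasurableSpace V] [BorelSpace V] [NormedAddCommGroup E] [InnerProductSpace ℂ E]
  [CompleteSpace E]

theorem fourier_toLp_ae {f : V → E} (hf : Integrable f) (hf2 : MemLp f 2 volume) :
    (𝓕 (hf2.toLp f) : Lp E 2 (volume : Measure V)) =ᵐ[volume] 𝓕 f := by
  have h_cont : Continuous (𝓕 f) :=
    VectorFourier.fourierIntegral_continuous Real.continuous_fourierChar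
      (by exact continuous_inner) hf
  refine ae_eq_of_integral_contDiff_smul_eq
    ((Lp.memLp _).locallyIntegrable one_le_two) h_cont.locallyIntegrable fun g hg hg_supp => ?_
  have hg_supp' : HasCompactSupport (Complex.ofRealCLM ∘ g) := hg_supp.comp_left rfl
  let G := hg_supp'.toSchwartzMap (Complex.ofRealCLM.contDiff.comp hg)
  have hG (x : V) (e : E) : G x • e = g x • e := by
    simp only [G, HasCompactSupport.toSchwartzMap_toFun, Function.comp_apply,
      Complex.ofRealCLM_apply, Complex.coe_smul]
  calc ∫ x, g x • (𝓕 (hf2.toLp f) : Lp E 2 (volume : Measure V)) x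
      = Lp.toTemperedDistribution (𝓕 (hf2.toLp f) : Lp E 2 (volume : Measure V)) G := by
        simp only [Lp.toTemperedDistribution_apply, hG]
    _ = Lp.toTemperedDistribution (hf2.toLp f) (𝓕 G) := by
        rw [← Lp.fourier_toTemperedDistribution_eq, TemperedDistribution.fourier_apply]
    _ = ∫ x, 𝓕 (G : V → ℂ) x • f x := by
        rw [Lp.toTemperedDistribution_apply, SchwartzMap.fourier_coe]
        refine integral_congr_ae ?_
        filter_upwards [hf2.coeFn_toLp] with x hx
        rw [hx]
    _ = ∫ x, G x • 𝓕 f x := by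
        have h := VectorFourier.integral_fourierIntegral_smul_eq_flip (L := innerₗ V)
          (μ := volume) (ν := volume)
          Real.continuous_fourierChar (by exact continuous_inner) G.integrable hf
        rwa [flip_innerₗ] at h
    _ = ∫ x, g x • 𝓕 f x := by simp only [hG]

end Fourier

theorem setLIntegral_comp_div (F : ℝ → ℝ≥0∞) (S : Set ℝ) {c : ℝ} (hc : 0 < c) :
    ∫⁻ t in S, F (t / c) = ENNReal.ofReal c * ∫⁻ u in (· * c) ⁻¹' S, F u := by
  have hc' : c⁻¹ ≠ 0 := inv_ne_zero hc.ne'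
  have h_embed := measurableEmbedding_mulRight₀ hc'
  have h := h_embed.lintegral_map F
    (μ := volume.restrict ((· * c⁻¹) ⁻¹' ((· * c) ⁻¹' S)))
  rw [← h_embed.restrict_map, Real.map_volume_mul_right hc', inv_inv, abs_of_pos hc,
    Measure.restrict_smul, lintegral_smul_measure, smul_eq_mul] at h
  rw [h, ← Set.preimage_comp]
  simp only [Function.comp_def, mul_assoc, inv_mul_cancel₀ hc.ne', mul_one, Set.preimage_id',
    div_eq_mul_inv]

theorem quasiMeasurePreserving_div_const {c : ℝ} (hc : c ≠ 0) :
    Measure.QuasiMeasurePreserving fun t : ℝ => t / c := by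
  refine ⟨by fun_prop, ?_⟩
  simp_rw [div_eq_mul_inv]
  rw [Real.map_volume_mul_right (inv_ne_zero hc)]
  exact Measure.smul_absolutelyContinuous

theorem fourierL2_toL2_ae (f : L2Density) :
    fourierL2 f.toL2 =ᵐ[volume] fourierInt f.toFun := by
  have h_plancherel := fourier_toLp_ae (V := ℝ) (E := ℂ) (f := fun x => (f.toFun x : ℂ))
    f.integrable.ofReal f.memLp.ofReal
  filter_upwards [(quasiMeasurePreserving_div_const Real.two_pi_pos.ne').ae h_plancherel] with t ht
  rw [fourierL2, L2Density.toL2, ht, fourierInt, Real.fourier_real_eq_integral_exp_smul]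
  congr! 4 with x
  field_simp
  push_cast
  ring_nf

theorem enorm_inv_sqrt_two_pi_mul_sq (z : ℂ) :
    ‖((√(2 * Real.pi))⁻¹ : ℝ) * z‖ₑ ^ 2 = ENNReal.ofReal (‖z‖ ^ 2 / (2 * Real.pi)) := by
  rw [← ofReal_norm, ← ENNReal.ofReal_pow (norm_nonneg _), norm_mul, Complex.norm_real,
    Real.norm_of_nonneg (by positivity), mul_pow, inv_pow, Real.sq_sqrt Real.two_pi_pos.le,
    inv_mul_eq_div]

/-- The energy in the frequency band `S`, a part of the `H_s`-loss on which the weight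
`(1 + t²)^s` is comparable to a constant. -/
noncomputable def bandEnergy (S : Set ℝ) (g : Lp ℂ 2 (volume : Measure ℝ)) : ℝ≥0∞ :=
  ∫⁻ t in S, ‖fourierL2 g t‖ₑ ^ 2

theorem bandEnergy_eq_enorm_sq (S : Set ℝ) (g : Lp ℂ 2 (volume : Measure ℝ)) :
    bandEnergy S g = ‖LpToLpRestrictCLM ℝ ℂ ℂ volume 2 ((· * (2 * Real.pi)) ⁻¹' S)
      (𝓕 g : Lp ℂ 2 (volume : Measure ℝ))‖ₑ ^ 2 := by
  have hpi : 0 < 2 * Real.pi := Real.two_pi_pos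
  have h_norm (t : ℝ) : ‖fourierL2 g t‖ₑ ^ 2 = ENNReal.ofReal (2 * Real.pi)⁻¹ *
      ‖(𝓕 g : Lp ℂ 2 (volume : Measure ℝ)) (t / (2 * Real.pi))‖ₑ ^ 2 := by
    rw [fourierL2, enorm_inv_sqrt_two_pi_mul_sq, div_eq_inv_mul,
      ENNReal.ofReal_mul (by positivity), ENNReal.ofReal_pow (norm_nonneg _), ofReal_norm]
  have h_eLpNorm := eLpNorm_nnreal_pow_eq_lintegral (p := 2)
    (μ := volume.restrict ((· * (2 * Real.pi)) ⁻¹' S)) (f := (𝓕 g : Lp ℂ 2 (volume : Measure ℝ)))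
    two_ne_zero
  rw [Lp.enorm_def, eLpNorm_congr_ae (LpToLpRestrictCLM_coeFn ℂ _ _), bandEnergy]
  simp_rw [h_norm]
  rw [lintegral_const_mul' _ _ ENNReal.ofReal_ne_top,
    setLIntegral_comp_div (fun u => ‖(𝓕 g : Lp ℂ 2 (volume : Measure ℝ)) u‖ₑ ^ 2) S hpi,
    ← mul_assoc, ← ENNReal.ofReal_mul (by positivity), inv_mul_cancel₀ hpi.ne',
    ENNReal.ofReal_one, one_mul]
  simpa using h_eLpNorm.symm

theorem continuous_bandEnergy (S : Set ℝ) : Continuous (bandEnergy S) := by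
  simp_rw [funext (bandEnergy_eq_enorm_sq S)]
  exact (ENNReal.continuous_pow 2).comp ((LpToLpRestrictCLM ℝ ℂ ℂ volume 2 _).continuous.comp
    (Lp.fourierTransformₗᵢ ℝ ℂ).continuous).enorm

theorem enorm_sub_sq_le {E : Type*} [SeminormedAddCommGroup E] (x y : E) :
    ‖x - y‖ₑ ^ 2 ≤ 2 * (‖x‖ₑ ^ 2 + ‖y‖ₑ ^ 2) := by
  refine (pow_le_pow_left' enorm_sub_le 2).trans ?_
  simp only [enorm_eq_nnnorm]
  exact_mod_cast add_sq_le (a := ‖x‖₊) (b := ‖y‖₊)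

theorem bandEnergy_sub_le (S : Set ℝ) (f₁ f₂ g : Lp ℂ 2 (volume : Measure ℝ)) :
    bandEnergy S (f₁ - f₂) ≤ 2 * (bandEnergy S (g - f₁) + bandEnergy S (g - f₂)) := by
  have h_fourier : (𝓕 (f₁ - f₂) : Lp ℂ 2 (volume : Measure ℝ)) = 𝓕 (g - f₂) - 𝓕 (g - f₁) := by
    rw [← sub_sub_sub_cancel_left f₂ f₁ g]
    exact map_sub (Lp.fourierTransformₗᵢ ℝ ℂ) _ _
  simp only [bandEnergy_eq_enorm_sq, h_fourier, map_sub]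
  exact (enorm_sub_sq_le _ _).trans_eq (by rw [add_comm])

theorem mul_bandEnergy_le_sobolevSq {s : ℝ} {W : ℝ≥0∞} (hW : W ≠ ∞) {S : Set ℝ}
    (hS : MeasurableSet S) (hWS : ∀ t ∈ S, W ≤ ENNReal.ofReal ((1 + t ^ 2) ^ s))
    (g : Lp ℂ 2 (volume : Measure ℝ)) : W * bandEnergy S g ≤ sobolevSq s g := by
  rw [bandEnergy, ← lintegral_const_mul' _ _ hW]
  refine (setLIntegral_mono' hS fun t ht => ?_).trans (setLIntegral_le_lintegral S _)
  rw [ENNReal.ofReal_mul (by positivity), ENNReal.ofReal_pow (norm_nonneg _), ofReal_norm]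
  gcongr
  exact hWS t ht

theorem fourierL2_sub_ae (g h : Lp ℂ 2 (volume : Measure ℝ)) :
    fourierL2 (g - h) =ᵐ[volume] fourierL2 g - fourierL2 h := by
  have h_fourier : (𝓕 (g - h) : Lp ℂ 2 (volume : Measure ℝ)) = 𝓕 g - 𝓕 h :=
    map_sub (Lp.fourierTransformₗᵢ ℝ ℂ) _ _
  filter_upwards [quasiMeasurePreserving_div_const Real.two_pi_pos.ne' |>.ae
    (Lp.coeFn_sub (𝓕 g : Lp ℂ 2 (volume : Measure ℝ)) (𝓕 h))] with t ht
  simp only [fourierL2, h_fourier, ht, Pi.sub_apply, mul_sub]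

theorem ofReal_mul_volume_le_bandEnergy {S : Set ℝ} (hS : MeasurableSet S) {c : ℝ} (hc : 0 ≤ c)
    {f₁ f₂ : L2Density}
    (h : ∀ t ∈ S, c ≤ ‖charFun (law f₁.toFun) (-t) - charFun (law f₂.toFun) (-t)‖) :
    ENNReal.ofReal (c ^ 2 / (2 * Real.pi)) * volume S ≤ bandEnergy S (f₁.toL2 - f₂.toL2) := by
  rw [bandEnergy, ← setLIntegral_const]
  refine setLIntegral_mono_ae' hS ?_
  filter_upwards [fourierL2_sub_ae f₁.toL2 f₂.toL2, fourierL2_toL2_ae f₁, fourierL2_toL2_ae f₂]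
    with t h_sub h₁ h₂ ht
  rw [h_sub, Pi.sub_apply, h₁, h₂, fourierInt_eq_charFun, fourierInt_eq_charFun, ← mul_sub,
    enorm_inv_sqrt_two_pi_mul_sq]
  gcongr
  exact h t ht

theorem sobolevSq_toL2 (s : ℝ) (f : L2Density) :
    sobolevSq s f.toL2 =
      ∫⁻ t, ENNReal.ofReal ((1 + t ^ 2) ^ s * (‖charFun (law f.toFun) t‖ ^ 2 / (2 * Real.pi))) := by
  refine lintegral_congr_ae ?_
  filter_upwards [fourierL2_toL2_ae f] with t ht
  rw [ht, fourierInt_eq_charFun, charFun_neg, norm_mul, RCLike.norm_conj, Complex.norm_real,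
    Real.norm_of_nonneg (by positivity), mul_pow, inv_pow, Real.sq_sqrt Real.two_pi_pos.le,
    inv_mul_eq_div]

theorem sobolevSq_conv_le (s : ℝ) (f : L2Density) (ν : Measure ℝ) [IsProbabilityMeasure ν] :
    sobolevSq s (f.conv ν).toL2 ≤ sobolevSq s f.toL2 := by
  rw [sobolevSq_toL2, sobolevSq_toL2]
  gcongr with t
  rw [L2Density.law_conv, charFun_conv, norm_mul]
  exact mul_le_of_le_one_right (norm_nonneg _) (norm_charFun_le_one t)

theorem pi_mono_measure {ι : Type*} [Fintype ι] {X : ι → Type*} [∀ i, MeasurableSpace (X i)]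
    {μ ν : ∀ i, Measure (X i)} [∀ i, SigmaFinite (μ i)] (h : ∀ i, μ i ≤ ν i) :
    Measure.pi μ ≤ Measure.pi ν := by
  have h_outer : (Measure.pi μ).toOuterMeasure ≤
      OuterMeasure.pi fun i => (ν i).toOuterMeasure :=
    OuterMeasure.le_pi.2 fun s _ =>
      (Measure.pi_pi μ s).trans_le (Finset.prod_le_prod' fun i _ => h i (s i))
  refine Measure.le_iff.2 fun s hs => ?_
  rw [Measure.pi_def ν, toMeasure_apply _ _ hs]
  exact h_outer s

/-- Le Cam's two-point argument for two laws with a common component `Γ`. -/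
theorem mul_measure_univ_le_lintegral_add {Z : Type*} [MeasurableSpace Z] {Γ P₁ P₂ : Measure Z}
    (h₁ : Γ ≤ P₁) (h₂ : Γ ≤ P₂) {ℓ₁ ℓ₂ : Z → ℝ≥0∞} (hℓ₁ : Measurable ℓ₁) {δ : ℝ≥0∞}
    (hδ : ∀ z, δ ≤ ℓ₁ z + ℓ₂ z) : δ * Γ Set.univ ≤ ∫⁻ z, ℓ₁ z ∂P₁ + ∫⁻ z, ℓ₂ z ∂P₂ :=
  calc δ * Γ Set.univ = ∫⁻ _, δ ∂Γ := (lintegral_const δ).symm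
    _ ≤ ∫⁻ z, ℓ₁ z + ℓ₂ z ∂Γ := lintegral_mono hδ
    _ = ∫⁻ z, ℓ₁ z ∂Γ + ∫⁻ z, ℓ₂ z ∂Γ := lintegral_add_left hℓ₁ _
    _ ≤ _ := add_le_add (lintegral_mono' h₁ le_rfl) (lintegral_mono' h₂ le_rfl)

section Minimax

variable {n m : ℕ} {s : ℝ} {𝒳 ℰ : Set L2Density}

theorem minimaxRisk_mono (n m : ℕ) (s : ℝ) (𝒳 : Set L2Density) {ℰ₁ ℰ₂ : Set L2Density}
    (h : ℰ₁ ⊆ ℰ₂) : minimaxRisk n m s 𝒳 ℰ₁ ≤ minimaxRisk n m s 𝒳 ℰ₂ :=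
  iInf₂_mono fun _ _ => iSup₂_mono fun _ _ => biSup_mono h

theorem risk_le_iSup (T : (Fin n → ℝ) × (Fin m → ℝ) → Lp ℂ 2 (volume : Measure ℝ))
    {f ε : L2Density} (hf : f ∈ 𝒳) (hε : ε ∈ ℰ) :
    risk n m s T f ε ≤ ⨆ (fX ∈ 𝒳) (fε ∈ ℰ), risk n m s T fX fε :=
  (le_iSup₂ (f := fun ε _ => risk n m s T f ε) ε hε).trans
    (le_iSup₂ (f := fun f _ => ⨆ ε ∈ ℰ, risk n m s T f ε) f hf)

theorem prod_pi_le_sampleLaw {f ε : L2Density} {α β : Measure ℝ}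
    (hα : α ≤ law f.toFun ∗ law ε.toFun) (hβ : β ≤ law ε.toFun) :
    (Measure.pi fun _ : Fin n => α).prod (Measure.pi fun _ : Fin m => β) ≤
      sampleLaw n m f ε := by
  have := isFiniteMeasure_of_le _ hα
  have := isFiniteMeasure_of_le _ hβ
  rw [sampleLaw, law_convDensity]
  exact Measure.prod_mono (pi_mono_measure fun _ => hα) (pi_mono_measure fun _ => hβ)

theorem le_minimaxRisk_of_common_component {S : Set ℝ} (hS : MeasurableSet S) {W : ℝ≥0∞}
    (hW : W ≠ ∞) (hWS : ∀ t ∈ S, W ≤ ENNReal.ofReal ((1 + t ^ 2) ^ s)) {f₁ f₂ ε₁ ε₂ : L2Density}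
    (hf₁ : f₁ ∈ 𝒳) (hf₂ : f₂ ∈ 𝒳) (hε₁ : ε₁ ∈ ℰ) (hε₂ : ε₂ ∈ ℰ) {α β : Measure ℝ}
    (hα₁ : α ≤ law f₁.toFun ∗ law ε₁.toFun) (hα₂ : α ≤ law f₂.toFun ∗ law ε₂.toFun)
    (hβ₁ : β ≤ law ε₁.toFun) (hβ₂ : β ≤ law ε₂.toFun) :
    W * bandEnergy S (f₁.toL2 - f₂.toL2) * (α Set.univ ^ n * β Set.univ ^ m) / 4 ≤
      minimaxRisk n m s 𝒳 ℰ := by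
  have := isFiniteMeasure_of_le _ hα₁
  have := isFiniteMeasure_of_le _ hβ₁
  set Γ := (Measure.pi fun _ : Fin n => α).prod (Measure.pi fun _ : Fin m => β)
  have hΓ : Γ Set.univ = α Set.univ ^ n * β Set.univ ^ m := by
    simp [Γ, Measure.pi_univ, ← Set.univ_prod_univ]
  refine le_iInf₂ fun T hT => ENNReal.div_le_of_le_mul ?_
  set R := ⨆ (fX ∈ 𝒳) (fε ∈ ℰ), risk n m s T fX fε
  have h_meas : Measurable fun z => W * (2 * bandEnergy S (T z - f₁.toL2)) :=
    (((continuous_bandEnergy S).comp_stronglyMeasurable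
      (hT.sub stronglyMeasurable_const)).measurable.const_mul 2).const_mul W
  have h_split (z) : W * bandEnergy S (f₁.toL2 - f₂.toL2) ≤
      W * (2 * bandEnergy S (T z - f₁.toL2)) + W * (2 * bandEnergy S (T z - f₂.toL2)) := by
    rw [← mul_add, ← mul_add]
    gcongr
    exact bandEnergy_sub_le S _ _ _
  have h_risk {f ε : L2Density} (hf : f ∈ 𝒳) (hε : ε ∈ ℰ) :
      ∫⁻ z, W * (2 * bandEnergy S (T z - f.toL2)) ∂sampleLaw n m f ε ≤ 2 * R := by
    simp_rw [mul_left_comm W]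
    rw [lintegral_const_mul' _ _ ENNReal.ofNat_ne_top]
    gcongr
    exact (lintegral_mono fun z => mul_bandEnergy_le_sobolevSq hW hS hWS _).trans
      (risk_le_iSup T hf hε)
  calc W * bandEnergy S (f₁.toL2 - f₂.toL2) * (α Set.univ ^ n * β Set.univ ^ m)
      ≤ 2 * R + 2 * R := by
        rw [← hΓ]
        exact (mul_measure_univ_le_lintegral_add (prod_pi_le_sampleLaw hα₁ hβ₁)
          (prod_pi_le_sampleLaw hα₂ hβ₂) h_meas h_split).trans
          (add_le_add (h_risk hf₁ hε₁) (h_risk hf₂ hε₂))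
    _ = R * 4 := by ring

end Minimax

section Lazy

open scoped unitInterval
open unitInterval (toNNReal)

/-- The law of a random variable which is `0` with probability `1 - q` and has law `μ` with
probability `q`. -/
noncomputable def lazy (q : I) (μ : Measure ℝ) : Measure ℝ :=
  toNNReal q • μ + toNNReal (σ q) • Measure.dirac 0

variable (q : I) (μ : Measure ℝ) [IsProbabilityMeasure μ]

instance isProbabilityMeasure_lazy : IsProbabilityMeasure (lazy q μ) :=
  inferInstanceAs (IsProbabilityMeasure (toNNReal q • μ + toNNReal (σ q) • Measure.dirac 0))

theorem charFun_lazy (t : ℝ) : charFun (lazy q μ) t = q * charFun μ t + (1 - q) := by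
  have h_int (ν : Measure ℝ) [IsFiniteMeasure ν] :
      Integrable (fun x : ℝ => Complex.exp (t * x * Complex.I)) ν :=
    .of_bound (by fun_prop) 1 <| .of_forall fun x => by
      rw [← Complex.ofReal_mul, Complex.norm_exp_ofReal_mul_I]
  rw [charFun_apply_real, lazy, integral_add_measure (h_int _) (h_int _),
    integral_smul_nnreal_measure, integral_smul_nnreal_measure, ← charFun_apply_real,
    ← charFun_apply_real, charFun_dirac]
  simp [NNReal.smul_def]

theorem one_sub_two_mul_le_norm_charFun_lazy (t : ℝ) : 1 - 2 * q ≤ ‖charFun (lazy q μ) t‖ := by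
  have h_symm : ‖(1 - q : ℂ)‖ = 1 - q := by
    rw [← Complex.ofReal_one, ← Complex.ofReal_sub, Complex.norm_real,
      Real.norm_of_nonneg (sub_nonneg.2 q.2.2)]
  have h_term : ‖q * charFun μ t‖ ≤ q := by
    rw [norm_mul, Complex.norm_real, Real.norm_of_nonneg q.2.1]
    exact mul_le_of_le_one_right q.2.1 (norm_charFun_le_one t)
  rw [charFun_lazy, add_comm]
  linarith [norm_sub_le_norm_add (1 - q : ℂ) (q * charFun μ t)]

end Lazy

section Decay

variable {a d d' η η₁ η₂ : ℝ} {μ ν : Measure ℝ}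

/-- The characteristic function of `ν` decays no faster than `exp (-η (1 + t²)^a)`. -/
def SlowDecay (a η : ℝ) (ν : Measure ℝ) : Prop :=
  ∀ t, Real.exp (-(η * (1 + t ^ 2) ^ a)) ≤ ‖charFun ν t‖

theorem one_le_one_add_sq_rpow (ha : 0 ≤ a) (t : ℝ) : 1 ≤ (1 + t ^ 2) ^ a :=
  Real.one_le_rpow (le_add_of_nonneg_right (sq_nonneg t)) ha

theorem SlowDecay.conv [IsFiniteMeasure μ] [IsFiniteMeasure ν] (hμ : SlowDecay a η₁ μ)
    (hν : SlowDecay a η₂ ν) : SlowDecay a (η₁ + η₂) (μ ∗ ν) := fun t => by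
  rw [charFun_conv, norm_mul, add_mul, neg_add, Real.exp_add]
  exact mul_le_mul (hμ t) (hν t) (Real.exp_pos _).le (norm_nonneg _)

theorem SlowDecay.lazy_of_le [IsProbabilityMeasure μ] (ha : 0 ≤ a) (hη : 0 ≤ η)
    {q : unitInterval} (hq : Real.exp (-η) ≤ 1 - 2 * q) : SlowDecay a η (lazy q μ) := fun t =>
  calc Real.exp (-(η * (1 + t ^ 2) ^ a)) ≤ Real.exp (-η) := by
        gcongr
        exact le_mul_of_one_le_right hη (one_le_one_add_sq_rpow ha t)
    _ ≤ 1 - 2 * q := hq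
    _ ≤ _ := one_sub_two_mul_le_norm_charFun_lazy q μ t

/-- The probability `1 - q` of staying at `0` must compensate for the vanishing of the Fejér
characteristic function outside `[-b, b]`, but it may be exponentially small in `b ^ (2 * a)`. -/
theorem SlowDecay.lazy_fejer (ha : 0 ≤ a) (hη : 0 ≤ η) {b : ℝ} (hb : 0 < b) {q : unitInterval}
    (hq : Real.exp (-(η * (((1 - Real.exp (-η)) * b) ^ 2) ^ a)) ≤ 1 - q) :
    SlowDecay a η (lazy q (law (L2Density.fejer b hb).toFun)) := fun t => by
  have h_tent := tent_nonneg b t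
  have h_norm : ‖charFun (lazy q (law (L2Density.fejer b hb).toFun)) t‖ =
      q * tent b t + (1 - q) := by
    rw [charFun_lazy, L2Density.charFun_fejer]
    norm_cast
    exact Real.norm_of_nonneg (add_nonneg (mul_nonneg q.2.1 h_tent) (sub_nonneg.2 q.2.2))
  rw [h_norm]
  have hδ : 0 ≤ 1 - Real.exp (-η) := sub_nonneg.2 (Real.exp_le_one_iff.2 (neg_nonpos.2 hη))
  rcases le_total |t| ((1 - Real.exp (-η)) * b) with h_near | h_far
  · calc Real.exp (-(η * (1 + t ^ 2) ^ a)) ≤ Real.exp (-η) := by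
          gcongr
          exact le_mul_of_one_le_right hη (one_le_one_add_sq_rpow ha t)
      _ ≤ 1 - |t| / b := by
          rw [le_sub_comm]
          exact (div_le_iff₀ hb).2 h_near
      _ ≤ tent b t := le_max_right _ _
      _ ≤ q * tent b t + (1 - q) := by
          nlinarith [mul_nonneg (sub_nonneg.2 q.2.2) (sub_nonneg.2 (tent_le_one hb.le t))]
  · calc Real.exp (-(η * (1 + t ^ 2) ^ a))
        ≤ Real.exp (-(η * (((1 - Real.exp (-η)) * b) ^ 2) ^ a)) := by
          gcongr
          rw [← sq_abs t]
          exact (pow_le_pow_left₀ (by positivity) h_far 2).trans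
            (le_add_of_nonneg_left zero_le_one)
      _ ≤ 1 - q := hq
      _ ≤ q * tent b t + (1 - q) := le_add_of_nonneg_left (mul_nonneg q.2.1 h_tent)

theorem le_mul_inv_abs_log_iff {u Q : ℝ} (hd : 0 < d) (hu₀ : 0 ≤ u) (hu₁ : u < 1) :
    (d ≤ Q * |Real.log u|⁻¹ ∧ Q * |Real.log u|⁻¹ ≤ d⁻¹) ↔
      Real.exp (-(Q / d)) ≤ u ∧ u ≤ Real.exp (-(d * Q)) := by
  rcases hu₀.eq_or_lt with rfl | hu₀
  · simp [hd.not_ge, (Real.exp_pos _).not_ge]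
  have h_log : 0 < -Real.log u := neg_pos.2 (Real.log_neg hu₀ hu₁)
  rw [← Real.le_log_iff_exp_le hu₀, ← Real.log_le_iff_le_exp hu₀, abs_of_neg (neg_pos.1 h_log),
    ← div_eq_mul_inv, le_div_iff₀ h_log, div_le_iff₀ h_log, inv_mul_eq_div, le_div_iff₀ hd,
    neg_le, le_div_iff₀ hd, le_neg, mul_comm d, mul_comm Q]

theorem mem_supersmoothWith_iff (hd : 0 < d) (f : L2Density) :
    f ∈ supersmoothWith a d ↔ ∀ t,
      2 * Real.pi * Real.exp (-((1 + t ^ 2) ^ a / d)) ≤ ‖charFun (law f.toFun) t‖ ^ 2 ∧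
      ‖charFun (law f.toFun) t‖ ^ 2 ≤ 2 * Real.pi * Real.exp (-(d * (1 + t ^ 2) ^ a)) := by
  have h_pi : 0 < 2 * Real.pi := by positivity
  have h_sq (t : ℝ) :
      ‖fourierInt f.toFun t‖ ^ 2 = ‖charFun (law f.toFun) t‖ ^ 2 / (2 * Real.pi) := by
    rw [fourierInt_eq_charFun, norm_mul, mul_pow, Complex.norm_real, charFun_neg, RCLike.norm_conj,
      Real.norm_of_nonneg (by positivity), inv_pow, Real.sq_sqrt h_pi.le, inv_mul_eq_div]
  have h_lt_one (t : ℝ) : ‖charFun (law f.toFun) t‖ ^ 2 / (2 * Real.pi) < 1 :=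
    (div_lt_one h_pi).2 <| (pow_le_one₀ (norm_nonneg _) (norm_charFun_le_one t)).trans_lt
      (by linarith [Real.pi_gt_three])
  refine forall_congr' fun t => ?_
  rw [h_sq, le_mul_inv_abs_log_iff hd (by positivity) (h_lt_one t), le_div_iff₀ h_pi,
    div_le_iff₀ h_pi, mul_comm (Real.exp _), mul_comm (Real.exp _)]

theorem L2Density.conv_mem_supersmoothWith [IsProbabilityMeasure ν] (hd : 0 < d) (hdd' : d < d')
    (hη : 2 * η ≤ d⁻¹ - d'⁻¹) {f : L2Density} (hf : f ∈ supersmoothWith a d')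
    (hν : SlowDecay a η ν) : f.conv ν ∈ supersmoothWith a d := by
  rw [mem_supersmoothWith_iff (hd.trans hdd')] at hf
  refine (mem_supersmoothWith_iff hd _).2 fun t => ?_
  have hQ : 0 ≤ (1 + t ^ 2) ^ a := by positivity
  rw [law_conv, charFun_conv, norm_mul, mul_pow]
  constructor
  · calc 2 * Real.pi * Real.exp (-((1 + t ^ 2) ^ a / d))
        ≤ 2 * Real.pi * Real.exp (-((1 + t ^ 2) ^ a / d')) *
            Real.exp (-(η * (1 + t ^ 2) ^ a)) ^ 2 := by
          rw [mul_assoc (2 * Real.pi), ← Real.exp_nat_mul, ← Real.exp_add]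
          gcongr
          push_cast
          rw [div_eq_mul_inv, div_eq_mul_inv]
          nlinarith
      _ ≤ _ := mul_le_mul (hf t).1 (pow_le_pow_left₀ (Real.exp_pos _).le (hν t) 2)
          (by positivity) (by positivity)
  · calc ‖charFun (law f.toFun) t‖ ^ 2 * ‖charFun ν t‖ ^ 2 ≤ ‖charFun (law f.toFun) t‖ ^ 2 :=
          mul_le_of_le_one_right (by positivity)
            (pow_le_one₀ (norm_nonneg _) (norm_charFun_le_one t))
      _ ≤ 2 * Real.pi * Real.exp (-(d' * (1 + t ^ 2) ^ a)) := (hf t).2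
      _ ≤ 2 * Real.pi * Real.exp (-(d * (1 + t ^ 2) ^ a)) := by gcongr

end Decay

section Existence

open ProbabilityTheory L2Density

theorem memLp_id_expMeasure {r : ℝ} (hr : 0 < r) {p : ℝ≥0∞} (hp₀ : p ≠ 0) (hp : p ≠ ∞) :
    MemLp id p (expMeasure r) := by
  rw [← integrable_norm_rpow_iff aestronglyMeasurable_id hp₀ hp, expMeasure, gammaMeasure,
    integrable_withDensity_iff (f := gammaPDF 1 r) (measurable_gammaPDFReal 1 r).ennreal_ofReal
      (ae_of_all _ fun _ => ENNReal.ofReal_lt_top)]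
  have h_gamma := integrableOn_rpow_mul_exp_neg_mul_rpow
    ((neg_one_lt_zero).trans_le (ENNReal.toReal_nonneg (a := p))) one_pos hr
  rw [← integrableOn_Ici_iff_integrableOn_Ioi] at h_gamma
  refine ((h_gamma.integrable_indicator measurableSet_Ici).const_mul r).congr
    (ae_of_all _ fun x => Eq.symm ?_)
  change _ * (exponentialPDF r x).toReal = r * _
  rw [exponentialPDF_eq]
  by_cases hx : 0 ≤ x
  · rw [if_pos hx, Set.indicator_of_mem (Set.mem_Ici.2 hx),
      ENNReal.toReal_ofReal (by positivity), id, Real.norm_of_nonneg hx, Real.rpow_one, neg_mul]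
    ring
  · rw [if_neg hx, Set.indicator_of_notMem (mt Set.mem_Ici.1 hx), ENNReal.ofReal_zero,
      ENNReal.toReal_zero, mul_zero, mul_zero]

theorem expMeasure_real_Ioi {r y : ℝ} (hr : 0 < r) (hy : 0 ≤ y) :
    (expMeasure r).real (Set.Ioi y) = Real.exp (-(r * y)) := by
  have := isProbabilityMeasure_expMeasure hr
  rw [← Set.compl_Iic, probReal_compl_eq_one_sub measurableSet_Iic, ← cdf_eq_real,
    cdf_expMeasure_eq hr, if_pos hy, sub_sub_cancel]

variable {a ω r t : ℝ}

/-- The bandwidth `R` with `(1 + R²) ^ a = 2 + ω⁺`. -/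
noncomputable def bandwidth (a ω : ℝ) : ℝ := √((2 + max ω 0) ^ a⁻¹ - 1)

theorem lt_bandwidth_iff (ha : 0 < a) (hr : 0 ≤ r) :
    r < bandwidth a ω ↔ (1 + r ^ 2) ^ a < 2 + max ω 0 := by
  rw [bandwidth, Real.lt_sqrt hr, lt_sub_iff_add_lt',
    Real.lt_rpow_inv_iff_of_pos (by positivity) (add_nonneg two_pos.le (le_max_right ω 0)) ha]

theorem bandwidth_pos (ha : 0 < a) (ω : ℝ) : 0 < bandwidth a ω :=
  Real.sqrt_pos.2 <| sub_pos.2 <|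
    Real.one_lt_rpow (by linarith [le_max_right ω 0]) (inv_pos.2 ha)

theorem measurable_bandwidth (a : ℝ) : Measurable (bandwidth a) := by
  unfold bandwidth
  fun_prop

theorem integrable_bandwidth (ha : 0 < a) : Integrable (bandwidth a) (expMeasure 1) := by
  have := isProbabilityMeasure_expMeasure one_pos
  have h_id : MemLp id (ENNReal.ofReal a⁻¹) (expMeasure 1) :=
    memLp_id_expMeasure one_pos (ENNReal.ofReal_pos.2 (inv_pos.2 ha)).ne' ENNReal.ofReal_ne_top
  have h_exp : MemLp (fun ω : ℝ => 2 + max ω 0) (ENNReal.ofReal a⁻¹) (expMeasure 1) :=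
    (memLp_const (2 : ℝ)).add h_id.pos_part
  refine h_exp.integrable_norm_rpow'.mono' (measurable_bandwidth a).aestronglyMeasurable
    (ae_of_all _ fun ω => ?_)
  have h_base : 1 ≤ 2 + max ω 0 := by linarith [le_max_right ω 0]
  rw [ENNReal.toReal_ofReal (inv_nonneg.2 ha.le), Real.norm_of_nonneg (bandwidth_pos ha ω).le,
    Real.norm_of_nonneg (zero_le_one.trans h_base), bandwidth, Real.sqrt_le_left]
  · nlinarith [Real.one_le_rpow h_base (inv_nonneg.2 ha.le)]
  · positivity

theorem aestronglyMeasurable_fejer_bandwidth (ha : 0 < a) {P : Measure ℝ} :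
    AEStronglyMeasurable (fun z : ℝ × ℝ => (fejer _ (bandwidth_pos ha z.1)).toFun z.2)
      (P.prod volume) := by
  have h_meas : Measurable fun z : ℝ × ℝ => (bandwidth a z.1, z.2) :=
    ((measurable_bandwidth a).comp measurable_fst).prodMk measurable_snd
  exact (continuous_fejerKernel.measurable.comp h_meas).aestronglyMeasurable

theorem integrable_integral_fejer_bandwidth_sq (ha : 0 < a) :
    Integrable (fun ω => ∫ x, (fejer _ (bandwidth_pos ha ω)).toFun x ^ 2) (expMeasure 1) := by
  have := isProbabilityMeasure_expMeasure one_pos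
  have h_meas := (aestronglyMeasurable_fejer_bandwidth ha (P := expMeasure 1)).fun_pow 2
  refine (integrable_bandwidth ha).mono' h_meas.integral_prod_right' (ae_of_all _ fun ω => ?_)
  have hω := (bandwidth_pos ha ω).le
  rw [Real.norm_of_nonneg (integral_nonneg fun _ => sq_nonneg _)]
  calc ∫ x, fejerKernel (bandwidth a ω) x ^ 2
      ≤ ∫ x, bandwidth a ω * fejerKernel (bandwidth a ω) x := by
        refine integral_mono (fejer _ (bandwidth_pos ha ω)).memLp.integrable_sq
          ((integrable_fejerKernel (bandwidth_pos ha ω)).const_mul _) fun x => ?_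
        rw [sq]
        exact mul_le_mul_of_nonneg_right (fejerKernel_le hω x) (fejerKernel_nonneg hω x)
    _ = bandwidth a ω := by
      rw [integral_const_mul, integral_fejerKernel (bandwidth_pos ha ω), mul_one]

/-- A supersmooth density with parameter `a`: the mixture of Fejér densities with random bandwidth
`R`, where `(1 + R²) ^ a - 2` has the standard exponential law. -/
noncomputable def fejerMixture (ha : 0 < a) : L2Density :=
  have := isProbabilityMeasure_expMeasure one_pos
  mixture (expMeasure 1) (fun ω => fejer _ (bandwidth_pos ha ω))
    (aestronglyMeasurable_fejer_bandwidth ha) (integrable_integral_fejer_bandwidth_sq ha)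

theorem norm_charFun_fejerMixture (ha : 0 < a) (t : ℝ) :
    ‖charFun (law (fejerMixture ha).toFun) t‖ = ∫ ω, tent (bandwidth a ω) t ∂expMeasure 1 := by
  have := isProbabilityMeasure_expMeasure one_pos
  simp only [fejerMixture, charFun_mixture, charFun_fejer]
  rw [integral_complex_ofReal, Complex.norm_real,
    Real.norm_of_nonneg (integral_nonneg fun _ => tent_nonneg _ _)]

theorem integrable_tent_bandwidth (ha : 0 < a) (t : ℝ) :
    Integrable (fun ω => tent (bandwidth a ω) t) (expMeasure 1) := by
  have := isProbabilityMeasure_expMeasure one_pos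
  have h_meas : Measurable fun ω => tent (bandwidth a ω) t :=
    measurable_const.max (measurable_const.sub (measurable_const.div (measurable_bandwidth a)))
  refine .of_bound h_meas.aestronglyMeasurable 1 (ae_of_all _ fun ω => ?_)
  rw [Real.norm_of_nonneg (tent_nonneg _ _)]
  exact tent_le_one (bandwidth_pos ha ω).le t

theorem norm_charFun_fejerMixture_le (ha : 0 < a) (ht : 2 ≤ (1 + t ^ 2) ^ a) :
    ‖charFun (law (fejerMixture ha).toFun) t‖ ≤ Real.exp (2 - (1 + t ^ 2) ^ a) := by
  have := isProbabilityMeasure_expMeasure one_pos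
  have h_tail := expMeasure_real_Ioi one_pos (sub_nonneg.2 ht)
  rw [one_mul, neg_sub] at h_tail
  rw [norm_charFun_fejerMixture, ← h_tail, ← integral_indicator_one measurableSet_Ioi]
  refine integral_mono (integrable_tent_bandwidth ha t)
    ((integrable_const 1).indicator measurableSet_Ioi) fun ω => ?_
  by_cases hω : ω ∈ Set.Ioi ((1 + t ^ 2) ^ a - 2)
  · rw [Set.indicator_of_mem hω]
    exact tent_le_one (bandwidth_pos ha ω).le t
  · rw [Set.indicator_of_notMem hω]
    refine (tent_eq_zero (bandwidth_pos ha ω) (le_of_not_gt fun h => hω ?_)).le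
    rw [lt_bandwidth_iff ha (abs_nonneg t), sq_abs, ← sub_lt_iff_lt_add', lt_max_iff] at h
    exact h.resolve_right (sub_nonneg.2 ht).not_gt

theorem le_norm_charFun_fejerMixture (ha : 0 < a) (t : ℝ) :
    Real.exp (-(4 ^ a * (1 + t ^ 2) ^ a)) / 2 ≤ ‖charFun (law (fejerMixture ha).toFun) t‖ := by
  have := isProbabilityMeasure_expMeasure one_pos
  have h_tail := expMeasure_real_Ioi one_pos
    (by positivity : (0 : ℝ) ≤ 4 ^ a * (1 + t ^ 2) ^ a)
  rw [one_mul] at h_tail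
  rw [norm_charFun_fejerMixture, ← h_tail, ← integral_indicator_one measurableSet_Ioi,
    ← integral_div]
  refine integral_mono (((integrable_const 1).indicator measurableSet_Ioi).div_const 2)
    (integrable_tent_bandwidth ha t) fun ω => ?_
  by_cases hω : ω ∈ Set.Ioi (4 ^ a * (1 + t ^ 2) ^ a)
  · rw [Set.indicator_of_mem hω]
    refine half_le_tent (bandwidth_pos ha ω) ((le_div_iff₀' two_pos).2 (le_of_lt ?_))
    rw [lt_bandwidth_iff ha (by positivity), mul_pow, sq_abs]
    calc (1 + 2 ^ 2 * t ^ 2) ^ a ≤ (4 * (1 + t ^ 2)) ^ a := by gcongr; linarith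
      _ = 4 ^ a * (1 + t ^ 2) ^ a := Real.mul_rpow (by norm_num) (by positivity)
      _ < 2 + max ω 0 := by linarith [le_max_left ω 0, Set.mem_Ioi.1 hω]
  · rw [Set.indicator_of_notMem hω, zero_div]
    exact tent_nonneg _ _

theorem norm_charFun_fejerMixture_sq_le (ha : 0 < a) (t : ℝ) :
    ‖charFun (law (fejerMixture ha).toFun) t‖ ^ 2 ≤ Real.exp (1 - (1 + t ^ 2) ^ a / 2) := by
  rcases le_total ((1 + t ^ 2) ^ a) 2 with h_small | h_large
  · calc ‖charFun (law (fejerMixture ha).toFun) t‖ ^ 2 ≤ 1 :=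
          pow_le_one₀ (norm_nonneg _) (norm_charFun_le_one t)
      _ ≤ _ := Real.one_le_exp (by linarith)
  · calc ‖charFun (law (fejerMixture ha).toFun) t‖ ^ 2
        ≤ Real.exp (2 - (1 + t ^ 2) ^ a) ^ 2 := by
          gcongr; exact norm_charFun_fejerMixture_le ha h_large
      _ ≤ _ := by
        rw [← Real.exp_nat_mul]
        gcongr
        push_cast
        linarith

theorem fejerMixture_mem_supersmoothWith (ha : 0 < a) :
    fejerMixture ha ∈ supersmoothWith a (2 * 4 ^ a + 4)⁻¹ := by
  refine (mem_supersmoothWith_iff (by positivity) _).2 fun t => ?_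
  have h_one := one_le_one_add_sq_rpow ha.le t
  set Q := (1 + t ^ 2) ^ a
  constructor
  · have h_const : 2 * Real.pi * 4 ≤ Real.exp (4 * Q) :=
      calc 2 * Real.pi * 4 ≤ 2.7 ^ 4 := by linarith [Real.pi_lt_four]
        _ ≤ Real.exp 1 ^ 4 := by gcongr; linarith [Real.exp_one_gt_d9]
        _ ≤ Real.exp (4 * Q) := by rw [← Real.exp_nat_mul]; gcongr; push_cast; linarith
    calc 2 * Real.pi * Real.exp (-(Q / (2 * 4 ^ a + 4)⁻¹))
        = 2 * Real.pi * 4 * (Real.exp (-(4 * Q)) * (Real.exp (-(4 ^ a * Q)) / 2) ^ 2) := by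
          rw [div_pow, ← Real.exp_nat_mul, mul_div_assoc', ← Real.exp_add, div_inv_eq_mul]
          ring_nf
      _ ≤ Real.exp (4 * Q) * (Real.exp (-(4 * Q)) * (Real.exp (-(4 ^ a * Q)) / 2) ^ 2) := by gcongr
      _ = (Real.exp (-(4 ^ a * Q)) / 2) ^ 2 := by
        rw [← mul_assoc, ← Real.exp_add, add_neg_cancel, Real.exp_zero, one_mul]
      _ ≤ _ := by gcongr; exact le_norm_charFun_fejerMixture ha t
  · calc ‖charFun (law (fejerMixture ha).toFun) t‖ ^ 2 ≤ Real.exp (1 - Q / 2) :=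
          norm_charFun_fejerMixture_sq_le ha t
      _ = Real.exp 1 * Real.exp (-(2⁻¹ * Q)) := by rw [← Real.exp_add]; ring_nf
      _ ≤ 2 * Real.pi * Real.exp (-((2 * 4 ^ a + 4)⁻¹ * Q)) := by
        gcongr
        · linarith [Real.exp_one_lt_d9, Real.pi_gt_three]
        · linarith [Real.rpow_pos_of_pos (four_pos (α := ℝ)) a]

end Existence

section Bumps

variable {b k p κ t : ℝ}

/-- The sum of the tents of half-width `b` centred at `k` and `-k`. -/
noncomputable def bumps (b k t : ℝ) : ℝ := tent b (t - k) + tent b (t + k)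

theorem bumps_nonneg (b k t : ℝ) : 0 ≤ bumps b k t :=
  add_nonneg (tent_nonneg b _) (tent_nonneg b _)

theorem bumps_neg (b k t : ℝ) : bumps b k (-t) = bumps b k t := by
  rw [bumps, bumps, ← tent_neg b (-t - k), ← tent_neg b (-t + k), add_comm]
  ring_nf

theorem bumps_le_two (hb : 0 ≤ b) (k t : ℝ) : bumps b k t ≤ 2 := by
  linarith [tent_le_one hb (t - k), tent_le_one hb (t + k), bumps.eq_1 b k t]

theorem bumps_eq_zero (hb : 0 < b) (h_sub : b ≤ |t - k|) (h_add : b ≤ |t + k|) :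
    bumps b k t = 0 := by
  rw [bumps, tent_eq_zero hb h_sub, tent_eq_zero hb h_add, add_zero]

theorem bumps_eq_zero_of_abs_le (hb : 0 < b) (ht : |t| ≤ k - b) : bumps b k t = 0 := by
  obtain ⟨h_left, h_right⟩ := abs_le.1 ht
  exact bumps_eq_zero hb (le_abs.2 (.inr (by linarith))) (le_abs.2 (.inl (by linarith)))

theorem bumps_eq_zero_of_le_abs (hb : 0 < b) (hk : 0 ≤ k) (ht : k + b ≤ |t|) :
    bumps b k t = 0 := by
  have := abs_sub_abs_le_abs_sub t k
  have := abs_sub_abs_le_abs_sub t (-k)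
  rw [abs_neg, sub_neg_eq_add] at this
  rw [abs_of_nonneg hk] at *
  exact bumps_eq_zero hb (by linarith) (by linarith)

theorem half_le_bumps (hb : 0 < b) (ht : t ∈ Set.Icc k (k + b / 2)) : 1 / 2 ≤ bumps b k t :=
  le_add_of_le_of_nonneg
    (half_le_tent hb (abs_le.2 ⟨by linarith [ht.1], by linarith [ht.2]⟩)) (tent_nonneg b _)

/-- The density with characteristic function `tent b + κ / 2 * bumps b k`. -/
noncomputable def L2Density.modulatedFejer (hb : 0 < b) (hbk : b ≤ k) (hκ : |κ| ≤ 1) : L2Density :=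
  (fejer b hb).modulate κ k hκ <| by
    rw [charFun_fejer, tent_eq_zero hb (hbk.trans (le_abs_self k)), Complex.ofReal_zero]

open L2Density

theorem charFun_modulatedFejer (hb : 0 < b) (hbk : b ≤ k) (hκ : |κ| ≤ 1) (t : ℝ) :
    charFun (law (modulatedFejer hb hbk hκ).toFun) t = ↑(tent b t + κ / 2 * bumps b k t) := by
  rw [modulatedFejer, charFun_modulate, charFun_fejer, charFun_fejer, charFun_fejer, bumps]
  push_cast
  rfl

theorem one_add_sq_rpow_mul_sq_le (hp : 0 ≤ p) (hb₀ : 0 < b) (hb₁ : b ≤ 1) (hk : 2 ≤ k)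
    (hκ : |κ| ≤ k ^ (-p)) (t : ℝ) :
    (1 + t ^ 2) ^ p * (tent b t + κ / 2 * bumps b k t) ^ 2 ≤
      4 ^ p * (tent b t + bumps b k t) := by
  have hk₀ : 0 < k := by linarith
  have h_tent₀ := tent_nonneg b t
  have h_tent₁ := tent_le_one hb₀.le t
  have h_bumps₀ := bumps_nonneg b k t
  rcases le_total |t| b with h_near | h_far
  · have h_t : 1 + t ^ 2 ≤ 4 := by rw [← sq_abs]; nlinarith [abs_nonneg t]
    rw [bumps_eq_zero_of_abs_le hb₀ (by linarith), mul_zero, add_zero]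
    gcongr
    exact pow_le_of_le_one h_tent₀ h_tent₁ two_ne_zero
  rw [tent_eq_zero hb₀ h_far, zero_add, zero_add]
  rcases le_total (k + b) |t| with h_out | h_in
  · rw [bumps_eq_zero_of_le_abs hb₀ hk₀.le h_out]
    simp
  have h_t : 1 + t ^ 2 ≤ 4 * k ^ 2 := by rw [← sq_abs]; nlinarith [abs_nonneg t]
  have h_κ : κ ^ 2 ≤ (k ^ 2) ^ (-p) := by
    rw [← sq_abs, ← Real.rpow_natCast_mul hk₀.le, mul_comm, Real.rpow_mul_natCast hk₀.le]
    exact pow_le_pow_left₀ (abs_nonneg κ) hκ 2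
  calc (1 + t ^ 2) ^ p * (κ / 2 * bumps b k t) ^ 2
      = (1 + t ^ 2) ^ p * κ ^ 2 * (bumps b k t ^ 2 / 4) := by ring
    _ ≤ (4 * k ^ 2) ^ p * (k ^ 2) ^ (-p) * bumps b k t := by
        gcongr
        nlinarith [bumps_le_two hb₀.le k t]
    _ = 4 ^ p * bumps b k t := by
        rw [Real.mul_rpow zero_le_four (sq_nonneg k), mul_assoc (4 ^ p),
          ← Real.rpow_add (by positivity), add_neg_cancel, Real.rpow_zero, mul_one]

theorem lintegral_tent_add_bumps_le (hb : 0 < b) (k : ℝ) :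
    ∫⁻ t, ENNReal.ofReal (tent b t + bumps b k t) ≤ ENNReal.ofReal (6 * b) := by
  have h_meas := (continuous_tent b).measurable
  simp_rw [ENNReal.ofReal_add (tent_nonneg b _) (bumps_nonneg b k _), bumps,
    ENNReal.ofReal_add (tent_nonneg b _) (tent_nonneg b _)]
  rw [lintegral_add_left (by fun_prop), lintegral_add_left (by fun_prop),
    lintegral_sub_right_eq_self (fun t => ENNReal.ofReal (tent b t)),
    lintegral_add_right_eq_self (fun t => ENNReal.ofReal (tent b t))]
  calc _ ≤ ENNReal.ofReal (2 * b) + (ENNReal.ofReal (2 * b) + ENNReal.ofReal (2 * b)) := by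
        gcongr <;> exact lintegral_tent_le hb
    _ = ENNReal.ofReal (6 * b) := by
        rw [← ENNReal.ofReal_add, ← ENNReal.ofReal_add] <;> first | positivity | ring_nf

theorem modulatedFejer_mem_sobolevDensities {ρ : ℝ} (hp : 0 ≤ p) (hb₀ : 0 < b) (hb₁ : b ≤ 1)
    (hbρ : b ≤ ρ / 4 ^ p) (hk : 2 ≤ k) (hbk : b ≤ k) (hκ₁ : |κ| ≤ 1) (hκ : |κ| ≤ k ^ (-p)) :
    modulatedFejer hb₀ hbk hκ₁ ∈ sobolevDensities p ρ := by
  have h_bound (t : ℝ) : (1 + t ^ 2) ^ p *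
      (‖charFun (law (modulatedFejer hb₀ hbk hκ₁).toFun) t‖ ^ 2 / (2 * Real.pi)) ≤
        4 ^ p / 6 * (tent b t + bumps b k t) := by
    have h_pi : 6 ≤ 2 * Real.pi := by linarith [Real.pi_gt_three]
    rw [charFun_modulatedFejer, Complex.norm_real, Real.norm_eq_abs, sq_abs,
      ← mul_div_assoc (_ ^ p), div_mul_eq_mul_div (4 ^ p)]
    have h_nonneg := add_nonneg (tent_nonneg b t) (bumps_nonneg b k t)
    exact div_le_div₀ (by positivity)
      (one_add_sq_rpow_mul_sq_le hp hb₀ hb₁ hk hκ t) (by norm_num) h_pi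
  rw [sobolevDensities, Set.mem_ofPred_eq, sobolevSq_toL2]
  calc ∫⁻ t, _ ≤ ∫⁻ t, ENNReal.ofReal (4 ^ p / 6) * ENNReal.ofReal (tent b t + bumps b k t) :=
        lintegral_mono fun t => by
          rw [← ENNReal.ofReal_mul (by positivity)]
          exact ENNReal.ofReal_le_ofReal (h_bound t)
    _ ≤ ENNReal.ofReal (4 ^ p / 6) * ENNReal.ofReal (6 * b) := by
        rw [lintegral_const_mul' _ _ ENNReal.ofReal_ne_top]
        gcongr
        exact lintegral_tent_add_bumps_le hb₀ k
    _ ≤ ENNReal.ofReal ρ := by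
        rw [← ENNReal.ofReal_mul (by positivity)]
        rw [le_div_iff₀ (by positivity)] at hbρ
        exact ENNReal.ofReal_le_ofReal (by linarith)

end Bumps

section TwoPoint

open scoped unitInterval
open unitInterval (toNNReal)

variable {n m : ℕ} {s : ℝ} {𝒳 ℰ : Set L2Density} {r : I} {X f : L2Density} {F ν₁ ν₂ : Measure ℝ}
  [IsProbabilityMeasure F] [IsProbabilityMeasure ν₁] [IsProbabilityMeasure ν₂]

theorem smul_conv_le_conv_lazy (q : I) (μ ν : Measure ℝ) [SFinite μ] [SFinite ν] :
    toNNReal q • (μ ∗ ν) ≤ μ ∗ lazy q ν := by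
  have : SFinite (toNNReal q • ν) := inferInstanceAs (SFinite ((toNNReal q : ℝ≥0∞) • ν))
  rw [lazy, Measure.conv_add]
  refine Measure.le_add_right (le_of_eq ?_)
  exact (Measure.conv_smul_right μ ν (toNNReal q : ℝ≥0∞)).symm

theorem conv_conv_conv_right_comm (μ₁ μ₂ μ₃ μ₄ : Measure ℝ) [IsFiniteMeasure μ₁]
    [IsFiniteMeasure μ₂] [IsFiniteMeasure μ₃] [IsFiniteMeasure μ₄] :
    ((μ₁ ∗ μ₂) ∗ μ₃) ∗ μ₄ = (μ₁ ∗ μ₃) ∗ (μ₄ ∗ μ₂) :=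
  Measure.ext_of_charFun <| funext fun t => by
    simp only [charFun_conv]
    ring

/-- If `F ∗ ν₁ = F ∗ ν₂`, then the laws of `Y` under the two signals `X ∗ ν₁` and `X ∗ ν₂` agree on
the event, of probability `r`, that the noise contains an independent summand with law `F`. -/
theorem le_minimaxRisk_of_signal {S : Set ℝ} (hS : MeasurableSet S) {W : ℝ≥0∞} (hW : W ≠ ∞)
    (hWS : ∀ t ∈ S, W ≤ ENNReal.ofReal ((1 + t ^ 2) ^ s)) (hF : F ∗ ν₁ = F ∗ ν₂)
    (h₁ : X.conv ν₁ ∈ 𝒳) (h₂ : X.conv ν₂ ∈ 𝒳) (hε : f.conv (lazy r F) ∈ ℰ) :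
    W * bandEnergy S ((X.conv ν₁).toL2 - (X.conv ν₂).toL2) * toNNReal r ^ n / 4 ≤
      minimaxRisk n m s 𝒳 ℰ := by
  have h_component (ν : Measure ℝ) [IsProbabilityMeasure ν] :
      toNNReal r • ((law X.toFun ∗ law f.toFun) ∗ (F ∗ ν)) ≤
        law (X.conv ν).toFun ∗ law (f.conv (lazy r F)).toFun := by
    rw [L2Density.law_conv, L2Density.law_conv,
      ← conv_conv_conv_right_comm (law X.toFun) ν (law f.toFun) F, ← Measure.conv_assoc]
    exact smul_conv_le_conv_lazy r _ F
  refine le_trans (le_of_eq ?_) (le_minimaxRisk_of_common_component hS hW hWS h₁ h₂ hε hε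
    (h_component ν₁) (hF ▸ h_component ν₂) le_rfl le_rfl)
  simp

/-- Exchanging `ν₁` and `ν₂` between signal and noise leaves the law of `Y` unchanged, so that only
the direct observations of the noise distinguish the two hypotheses. -/
theorem le_minimaxRisk_of_noise {S : Set ℝ} (hS : MeasurableSet S) {W : ℝ≥0∞} (hW : W ≠ ∞)
    (hWS : ∀ t ∈ S, W ≤ ENNReal.ofReal ((1 + t ^ 2) ^ s)) (hF : F ∗ ν₁ = F ∗ ν₂)
    (h₁ : X.conv ν₁ ∈ 𝒳) (h₂ : X.conv ν₂ ∈ 𝒳) (hε₁ : f.conv (lazy r F ∗ ν₂) ∈ ℰ)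
    (hε₂ : f.conv (lazy r F ∗ ν₁) ∈ ℰ) :
    W * bandEnergy S ((X.conv ν₁).toL2 - (X.conv ν₂).toL2) * toNNReal r ^ m / 4 ≤
      minimaxRisk n m s 𝒳 ℰ := by
  have h_component (ν : Measure ℝ) [IsProbabilityMeasure ν] :
      toNNReal r • (law f.toFun ∗ (F ∗ ν)) ≤ law (f.conv (lazy r F ∗ ν)).toFun := by
    rw [L2Density.law_conv, Measure.conv_comm F, Measure.conv_comm (lazy r F),
      ← Measure.conv_assoc, ← Measure.conv_assoc]
    exact smul_conv_le_conv_lazy r _ F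
  have h_exchange : law (X.conv ν₁).toFun ∗ law (f.conv (lazy r F ∗ ν₂)).toFun =
      law (X.conv ν₂).toFun ∗ law (f.conv (lazy r F ∗ ν₁)).toFun :=
    Measure.ext_of_charFun <| funext fun t => by
      simp only [L2Density.law_conv, charFun_conv]
      ring
  refine le_trans (le_of_eq ?_) (le_minimaxRisk_of_common_component hS hW hWS h₁ h₂ hε₁ hε₂
    le_rfl h_exchange.le (hF ▸ h_component ν₂) (h_component ν₁))
  simp

theorem le_minimaxRisk_of_slowDecay {a d d' η : ℝ} (hd : 0 < d) (hdd' : d < d') (hη₀ : 0 ≤ η)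
    (hη : 4 * η ≤ d⁻¹ - d'⁻¹) (hf : f ∈ supersmoothWith a d') (h_lazy : SlowDecay a η (lazy r F))
    (hν₁ : SlowDecay a η ν₁) (hν₂ : SlowDecay a η ν₂) {S : Set ℝ} (hS : MeasurableSet S) {W : ℝ≥0∞}
    (hW : W ≠ ∞) (hWS : ∀ t ∈ S, W ≤ ENNReal.ofReal ((1 + t ^ 2) ^ s)) (hF : F ∗ ν₁ = F ∗ ν₂)
    (h₁ : X.conv ν₁ ∈ 𝒳) (h₂ : X.conv ν₂ ∈ 𝒳) (hr : 1 / 2 ≤ (r : ℝ) ^ min n m) :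
    W * bandEnergy S ((X.conv ν₁).toL2 - (X.conv ν₂).toL2) / 8 ≤
      minimaxRisk n m s 𝒳 (supersmoothWith a d) := by
  have h_half {N : ℕ} (hN : 1 / 2 ≤ (r : ℝ) ^ N) (E : ℝ≥0∞) : E / 8 ≤ E * toNNReal r ^ N / 4 := by
    have h_pow : (2 : ℝ≥0∞)⁻¹ ≤ (toNNReal r : ℝ≥0∞) ^ N := by
      rw [← ENNReal.coe_ofNat, ← ENNReal.coe_inv two_ne_zero]
      exact_mod_cast (one_div (2 : ℝ) ▸ hN : (2 : ℝ)⁻¹ ≤ (r : ℝ) ^ N)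
    calc E / 8 = E * 2⁻¹ / 4 := by
          rw [div_eq_mul_inv, div_eq_mul_inv, mul_assoc, ← ENNReal.mul_inv (by simp) (by simp)]
          norm_num
      _ ≤ _ := by gcongr
  have h_noise {ν : Measure ℝ} [IsProbabilityMeasure ν] (hν : SlowDecay a η ν) :
      f.conv (lazy r F ∗ ν) ∈ supersmoothWith a d :=
    L2Density.conv_mem_supersmoothWith hd hdd' (by linarith) hf (h_lazy.conv hν)
  rcases min_choice n m with h_min | h_min <;> rw [h_min] at hr
  · exact (h_half hr _).trans <| le_minimaxRisk_of_signal hS hW hWS hF h₁ h₂ <|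
      L2Density.conv_mem_supersmoothWith hd hdd' (by linarith) hf h_lazy
  · exact (h_half hr _).trans <|
      le_minimaxRisk_of_noise hS hW hWS hF h₁ h₂ (h_noise hν₂) (h_noise hν₁)

end TwoPoint

section Frequency

open L2Density
open scoped unitInterval
open unitInterval (toNNReal)

variable {b k κ θ θ₁ θ₂ : ℝ}

/-- The perturbation of `dirac 0` at the frequencies `±k`, of size `q` and with sign `θ`, by which
the two competing hypotheses differ. -/
noncomputable def perturbation (q : I) (hb : 0 < b) (hbk : b ≤ k) (hθ : |θ| ≤ 1) : Measure ℝ :=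
  lazy q (law (modulatedFejer hb hbk hθ).toFun)

instance isProbabilityMeasure_perturbation (q : I) (hb : 0 < b) (hbk : b ≤ k) (hθ : |θ| ≤ 1) :
    IsProbabilityMeasure (perturbation q hb hbk hθ) :=
  isProbabilityMeasure_lazy _ _

theorem charFun_perturbation (q : I) (hb : 0 < b) (hbk : b ≤ k) (hθ : |θ| ≤ 1) (t : ℝ) :
    charFun (perturbation q hb hbk hθ) t =
      ↑(q * (tent b t + θ / 2 * bumps b k t) + (1 - q) : ℝ) := by
  rw [perturbation, charFun_lazy, charFun_modulatedFejer]
  push_cast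
  rfl

theorem law_fejer_conv_perturbation {R : ℝ} (q : I) (hR : 0 < R) (hb : 0 < b) (hbk : b ≤ k)
    (hRk : R ≤ k - b) (hθ₁ : |θ₁| ≤ 1) (hθ₂ : |θ₂| ≤ 1) :
    law (fejer R hR).toFun ∗ perturbation q hb hbk hθ₁ =
      law (fejer R hR).toFun ∗ perturbation q hb hbk hθ₂ := by
  refine Measure.ext_of_charFun (funext fun t => ?_)
  rw [charFun_conv, charFun_conv, charFun_perturbation, charFun_perturbation, charFun_fejer]
  rcases le_total R |t| with h_far | h_near
  · rw [tent_eq_zero hR h_far, Complex.ofReal_zero, zero_mul, zero_mul]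
  · rw [bumps_eq_zero_of_abs_le hb (h_near.trans hRk), mul_zero, mul_zero]

theorem norm_charFun_conv_perturbation_sub (q : I) (hb : 0 < b) (hbk : b ≤ k) (hκ : |κ| ≤ 1)
    (hθ₁ : |θ₁| ≤ 1) (hθ₂ : |θ₂| ≤ 1) {t : ℝ} (ht : b ≤ |t|) :
    ‖charFun (law ((modulatedFejer hb hbk hκ).conv (perturbation q hb hbk hθ₁)).toFun) t -
      charFun (law ((modulatedFejer hb hbk hκ).conv (perturbation q hb hbk hθ₂)).toFun) t‖ =
        |κ| * q * |θ₁ - θ₂| / 4 * bumps b k t ^ 2 := by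
  have h_diff : κ / 2 * bumps b k t * (q * (θ₁ / 2 * bumps b k t) + (1 - q)) -
      κ / 2 * bumps b k t * (q * (θ₂ / 2 * bumps b k t) + (1 - q)) =
        κ * q * (θ₁ - θ₂) / 4 * bumps b k t ^ 2 := by ring
  simp only [law_conv, charFun_conv, charFun_modulatedFejer, charFun_perturbation,
    tent_eq_zero hb ht, zero_add]
  rw [← Complex.ofReal_mul, ← Complex.ofReal_mul, ← Complex.ofReal_sub, Complex.norm_real, h_diff,
    Real.norm_eq_abs, abs_mul, abs_div, abs_mul, abs_mul, abs_of_nonneg q.2.1,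
    abs_of_nonneg (sq_nonneg (bumps b k t)), Nat.abs_ofNat]

theorem ofReal_le_bandEnergy_perturbation (q : I) (hb : 0 < b) (hbk : b ≤ k) (hκ : |κ| ≤ 1)
    (hθ₁ : |θ₁| ≤ 1) (hθ₂ : |θ₂| ≤ 1) :
    ENNReal.ofReal ((|κ| * q * |θ₁ - θ₂| / 16) ^ 2 / (2 * Real.pi) * (b / 2)) ≤
      bandEnergy (Set.Icc k (k + b / 2))
        (((modulatedFejer hb hbk hκ).conv (perturbation q hb hbk hθ₁)).toL2 -
          ((modulatedFejer hb hbk hκ).conv (perturbation q hb hbk hθ₂)).toL2) := by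
  have h_size : 0 ≤ |κ| * q * |θ₁ - θ₂| :=
    mul_nonneg (mul_nonneg (abs_nonneg κ) q.2.1) (abs_nonneg _)
  rw [ENNReal.ofReal_mul (by positivity), ← add_sub_cancel_left k (b / 2), ← Real.volume_Icc,
    add_sub_cancel_left]
  refine ofReal_mul_volume_le_bandEnergy measurableSet_Icc (by positivity) fun t ht => ?_
  have h_bumps := half_le_bumps hb ht
  rw [norm_charFun_conv_perturbation_sub q hb hbk hκ hθ₁ hθ₂
    (by rw [abs_neg]; exact hbk.trans (ht.1.trans (le_abs_self t))), bumps_neg]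
  calc |κ| * q * |θ₁ - θ₂| / 16 = |κ| * q * |θ₁ - θ₂| / 4 * (1 / 2) ^ 2 := by ring
    _ ≤ |κ| * q * |θ₁ - θ₂| / 4 * bumps b k t ^ 2 := by gcongr

theorem ofReal_le_mul_bandEnergy_perturbation (q : I) (hb : 0 < b) (hbk : b ≤ k) (hk : 0 < k)
    (s : ℝ) (hκ : |k ^ (-p)| ≤ 1) (hθ₁ : |θ₁| ≤ 1) (hθ₂ : |θ₂| ≤ 1) :
    ENNReal.ofReal ((q * |θ₁ - θ₂| / 16) ^ 2 / (2 * Real.pi) * (b / 2) * (k ^ 2) ^ (s - p)) ≤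
      ENNReal.ofReal ((k ^ 2) ^ s) * bandEnergy (Set.Icc k (k + b / 2))
        (((modulatedFejer hb hbk hκ).conv (perturbation q hb hbk hθ₁)).toL2 -
          ((modulatedFejer hb hbk hκ).conv (perturbation q hb hbk hθ₂)).toL2) := by
  have h_power : (k ^ 2) ^ (s - p) = (k ^ 2) ^ s * (k ^ (-p)) ^ 2 := by
    rw [sub_eq_add_neg, Real.rpow_add (by positivity), Real.rpow_pow_comm hk.le]
  refine le_trans (le_of_eq ?_)
    (mul_le_mul_right (ofReal_le_bandEnergy_perturbation q hb hbk hκ hθ₁ hθ₂) _)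
  rw [← ENNReal.ofReal_mul (by positivity), abs_of_pos (Real.rpow_pos_of_pos hk _), h_power]
  ring_nf

theorem one_half_le_pow {τ : ℝ} (hτ : τ ≤ 1) {N : ℕ} (h : N * τ ≤ 1 / 2) : 1 / 2 ≤ (1 - τ) ^ N := by
  have := one_add_mul_le_pow (a := -τ) (by linarith) N
  rw [← sub_eq_add_neg] at this
  linarith

end Frequency

section LowerBound

open L2Density
open scoped unitInterval

variable {a b d d' k p s ρ η : ℝ} {n m : ℕ}

theorem le_minimaxRisk_of_perturbation (ha : 0 ≤ a) (hs : 0 ≤ s) (hp : 0 ≤ p) (hd : 0 < d)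
    (hdd' : d < d') (hη₀ : 0 ≤ η) (hη : 4 * η ≤ d⁻¹ - d'⁻¹) {f : L2Density}
    (hf : f ∈ supersmoothWith a d') (hb₀ : 0 < b) (hb₁ : b ≤ 1) (hbρ : b ≤ ρ / 4 ^ p) (hk : 2 ≤ k)
    {q r : I} (hq : Real.exp (-η) ≤ 1 - 2 * q)
    (hr : Real.exp (-(η * (((1 - Real.exp (-η)) * (k / 2)) ^ 2) ^ a)) ≤ 1 - r)
    (hr_pow : 1 / 2 ≤ (r : ℝ) ^ min n m) :
    ENNReal.ofReal ((q / 8) ^ 2 / (2 * Real.pi) * (b / 2) * (k ^ 2) ^ (s - p)) / 8 ≤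
      minimaxRisk n m s (sobolevDensities p ρ) (supersmoothWith a d) := by
  have hk₀ : 0 < k := by linarith
  have hbk : b ≤ k := by linarith
  have h_pos : 0 < k ^ (-p) := Real.rpow_pos_of_pos hk₀ _
  have hκ : |k ^ (-p)| ≤ 1 := by
    rw [abs_of_pos h_pos]
    exact Real.rpow_le_one_of_one_le_of_nonpos (by linarith) (neg_nonpos.2 hp)
  have h_signal {θ : ℝ} (hθ : |θ| ≤ 1) :
      (modulatedFejer hb₀ hbk hκ).conv (perturbation q hb₀ hbk hθ) ∈ sobolevDensities p ρ :=
    (sobolevSq_conv_le p _ _).trans <|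
      modulatedFejer_mem_sobolevDensities hp hb₀ hb₁ hbρ hk hbk hκ (abs_of_pos h_pos).le
  have h_weight : ∀ t ∈ Set.Icc k (k + b / 2),
      ENNReal.ofReal ((k ^ 2) ^ s) ≤ ENNReal.ofReal ((1 + t ^ 2) ^ s) := fun t ht => by
    gcongr
    nlinarith [ht.1]
  have h_one : |(1 : ℝ)| ≤ 1 := abs_one.le
  have h_neg_one : |(-1 : ℝ)| ≤ 1 := by rw [abs_neg, abs_one]
  have h_gap : q * |(1 : ℝ) - -1| / 16 = q / 8 := by norm_num; ring
  calc ENNReal.ofReal ((q / 8) ^ 2 / (2 * Real.pi) * (b / 2) * (k ^ 2) ^ (s - p)) / 8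
      = ENNReal.ofReal ((q * |1 - -1| / 16) ^ 2 / (2 * Real.pi) * (b / 2) *
          (k ^ 2) ^ (s - p)) / 8 := by rw [h_gap]
    _ ≤ _ := by
      gcongr
      exact ofReal_le_mul_bandEnergy_perturbation q hb₀ hbk hk₀ s hκ h_one h_neg_one
    _ ≤ _ := le_minimaxRisk_of_slowDecay hd hdd' hη₀ hη hf
      (SlowDecay.lazy_fejer ha hη₀ (half_pos hk₀) hr) (SlowDecay.lazy_of_le ha hη₀ hq)
      (SlowDecay.lazy_of_le ha hη₀ hq) measurableSet_Icc ENNReal.ofReal_ne_top h_weight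
      (law_fejer_conv_perturbation q (half_pos hk₀) hb₀ hbk (by linarith) h_one h_neg_one)
      (h_signal h_one) (h_signal h_neg_one) hr_pow

theorem exists_le_minimaxRisk_at_frequency (ha : 0 ≤ a) (hs : 0 ≤ s) (hp : 0 ≤ p) (hρ : 0 < ρ)
    (hd : 0 < d) (hdd' : d < d') (hne : (supersmoothWith a d').Nonempty) :
    ∃ c > 0, ∃ C > 0, ∀ k : ℝ, 2 ≤ k → ∀ n m : ℕ,
      ↑(min n m) * Real.exp (-(c * (k ^ 2) ^ a)) ≤ 1 / 2 →
        ENNReal.ofReal (C * (k ^ 2) ^ (s - p)) ≤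
          minimaxRisk n m s (sobolevDensities p ρ) (supersmoothWith a d) := by
  obtain ⟨f, hf⟩ := hne
  set η := (d⁻¹ - d'⁻¹) / 4
  have hη₀ : 0 < η := div_pos (sub_pos.2 (inv_strictAnti₀ hd hdd')) four_pos
  have h_exp : Real.exp (-η) < 1 := Real.exp_lt_one_iff.2 (neg_neg_iff_pos.2 hη₀)
  set x := 1 - Real.exp (-η)
  have : 0 < x := sub_pos.2 h_exp
  let q : I := ⟨x / 2, by positivity, by linarith [Real.exp_pos (-η)]⟩
  have hb₀ : 0 < min 1 (ρ / 4 ^ p) := lt_min one_pos (by positivity)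
  refine ⟨η * ((x / 2) ^ 2) ^ a, by positivity,
    (x / 2 / 8) ^ 2 / (2 * Real.pi) * (min 1 (ρ / 4 ^ p) / 2) / 8, by positivity,
    fun k hk n m h_small => ?_⟩
  have h_rate : η * ((x / 2) ^ 2) ^ a * (k ^ 2) ^ a = η * ((x * (k / 2)) ^ 2) ^ a := by
    rw [mul_assoc, ← Real.mul_rpow (by positivity) (by positivity)]
    ring_nf
  rw [h_rate] at h_small
  set τ := Real.exp (-(η * ((x * (k / 2)) ^ 2) ^ a))
  have hτ : τ ≤ 1 := Real.exp_le_one_iff.2 (neg_nonpos.2 (by positivity))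
  let r : I := ⟨1 - τ, sub_nonneg.2 hτ, sub_le_self _ (Real.exp_nonneg _)⟩
  rw [div_mul_eq_mul_div, ENNReal.ofReal_div_of_pos (by norm_num), ENNReal.ofReal_ofNat]
  exact le_minimaxRisk_of_perturbation (q := q) (r := r) ha hs hp hd hdd' hη₀.le
    (mul_div_cancel₀ _ four_ne_zero).le hf hb₀ (min_le_left _ _) (min_le_right _ _) hk
    (show Real.exp (-η) ≤ 1 - 2 * (x / 2) by linarith) (sub_sub_cancel 1 τ).ge
    (one_half_le_pow hτ h_small)

theorem exists_undetectable_frequency {c : ℝ} (ha : 0 < a) (hc : 0 < c) :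
    ∃ K > 0, ∀ N : ℕ, 2 ≤ N → ∃ k : ℝ, 2 ≤ k ∧ k ^ 2 = (K * Real.log N) ^ a⁻¹ ∧
      N * Real.exp (-(c * (k ^ 2) ^ a)) ≤ 1 / 2 := by
  have h_log_two : 0 < Real.log 2 := Real.log_pos one_lt_two
  set K := max (4 ^ a / Real.log 2) (2 / c)
  have hK : 0 < K := lt_max_of_lt_right (by positivity)
  refine ⟨K, hK, fun N hN => ?_⟩
  have hN_cast : (2 : ℝ) ≤ N := by exact_mod_cast hN
  have h_log : Real.log 2 ≤ Real.log N := Real.log_le_log two_pos hN_cast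
  have h_nonneg : 0 ≤ K * Real.log N := mul_nonneg hK.le (h_log_two.le.trans h_log)
  have h_sq : √((K * Real.log N) ^ a⁻¹) ^ 2 = (K * Real.log N) ^ a⁻¹ :=
    Real.sq_sqrt (Real.rpow_nonneg h_nonneg _)
  refine ⟨√((K * Real.log N) ^ a⁻¹), ?_, h_sq, ?_⟩
  · rw [Real.le_sqrt' two_pos, Real.le_rpow_inv_iff_of_pos (by norm_num) h_nonneg ha]
    calc ((2 : ℝ) ^ 2) ^ a = 4 ^ a / Real.log 2 * Real.log 2 := by
          rw [div_mul_cancel₀ _ h_log_two.ne']; norm_num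
      _ ≤ K * Real.log N := by gcongr; exact le_max_left _ _
  · rw [h_sq, Real.rpow_inv_rpow h_nonneg ha.ne']
    have h_two : 2 ≤ c * K := by
      rw [← div_le_iff₀' hc]
      exact le_max_right _ _
    calc N * Real.exp (-(c * (K * Real.log N))) ≤ N * Real.exp (-(2 * Real.log N)) := by
          rw [← mul_assoc]
          gcongr
      _ = (N : ℝ)⁻¹ := by
          rw [two_mul, neg_add, Real.exp_add, Real.exp_neg, Real.exp_log (by linarith),
            mul_inv_cancel_left₀ (by positivity)]
      _ ≤ 1 / 2 := by rw [one_div]; gcongr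

theorem exists_le_minimaxRisk_log (ha : 0 < a) (hs : 0 ≤ s) (hsp : s ≤ p) (hρ : 0 < ρ)
    (hd : 0 < d) (hdd' : d < d') (hne : (supersmoothWith a d').Nonempty) :
    ∃ C > 0, ∀ n m : ℕ, 2 ≤ n → 2 ≤ m →
      ENNReal.ofReal (C * (Real.log n ^ (-(p - s) / a) + Real.log m ^ (-(p - s) / a))) ≤
        minimaxRisk n m s (sobolevDensities p ρ) (supersmoothWith a d) := by
  obtain ⟨c, hc, C, hC, h_risk⟩ :=
    exists_le_minimaxRisk_at_frequency ha.le hs (hs.trans hsp) hρ hd hdd' hne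
  obtain ⟨K, hK, h_frequency⟩ := exists_undetectable_frequency ha hc
  set γ := -(p - s) / a with hγ
  have hγ_nonpos : γ ≤ 0 := div_nonpos_of_nonpos_of_nonneg (by linarith) ha.le
  refine ⟨C * K ^ γ / 2, by positivity, fun n m hn hm => ?_⟩
  obtain ⟨k, hk, hk_sq, h_small⟩ := h_frequency (min n m) (le_min hn hm)
  refine le_trans (ENNReal.ofReal_le_ofReal ?_) (h_risk k hk n m h_small)
  have h_log_pos {N : ℕ} (hN : 2 ≤ N) : 0 < Real.log N := Real.log_pos (by exact_mod_cast hN)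
  have h_anti {N : ℕ} (hN : min n m ≤ N) : Real.log N ^ γ ≤ Real.log ↑(min n m) ^ γ := by
    have h_min : 2 ≤ min n m := le_min hn hm
    refine Real.rpow_le_rpow_of_nonpos (h_log_pos h_min) (Real.log_le_log ?_ ?_) hγ_nonpos
    · exact_mod_cast two_pos.trans_le h_min
    · exact_mod_cast hN
  calc C * K ^ γ / 2 * (Real.log n ^ γ + Real.log m ^ γ)
      ≤ C * K ^ γ / 2 * (Real.log ↑(min n m) ^ γ + Real.log ↑(min n m) ^ γ) := by
        gcongr C * K ^ γ / 2 * (?_ + ?_)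
        exacts [h_anti (min_le_left n m), h_anti (min_le_right n m)]
    _ = C * (K * Real.log ↑(min n m)) ^ γ := by
        rw [Real.mul_rpow hK.le (h_log_pos (le_min hn hm)).le]
        ring
    _ = C * (k ^ 2) ^ (s - p) := by
        rw [hk_sq, ← Real.rpow_mul (mul_pos hK (h_log_pos (le_min hn hm))).le, hγ, neg_sub,
          div_eq_inv_mul]

end LowerBound

end Deconvolution

theorem corollary4p9 (a p s ρ : ℝ) (ha : 0 < a) (hs : 0 ≤ s) (hsp : s < p) (hρ : 0 < ρ) :
    (∃ C : ℝ, 0 < C ∧ ∀ n m : ℕ, 2 ≤ n → 2 ≤ m →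
      ENNReal.ofReal
          (C * ((Real.log n) ^ (-(p - s) / a) + (Real.log m) ^ (-(p - s) / a))) ≤
        Deconvolution.minimaxRisk n m s
          (Deconvolution.sobolevDensities p ρ) (Deconvolution.supersmooth a)) ∧
    (∀ d d' : ℝ, 0 < d → d < d' → (Deconvolution.supersmoothWith a d').Nonempty →
      ∃ C : ℝ, 0 < C ∧ ∀ n m : ℕ, 2 ≤ n → 2 ≤ m →
        ENNReal.ofReal
            (C * ((Real.log n) ^ (-(p - s) / a) + (Real.log m) ^ (-(p - s) / a))) ≤
          Deconvolution.minimaxRisk n m s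
            (Deconvolution.sobolevDensities p ρ) (Deconvolution.supersmoothWith a d)) := by
  have h_fixed := fun (d d' : ℝ) (hd : 0 < d) (hdd' : d < d') hne =>
    Deconvolution.exists_le_minimaxRisk_log ha hs hsp.le hρ hd hdd' hne
  refine ⟨?_, h_fixed⟩
  set d : ℝ := (2 * 4 ^ a + 4)⁻¹
  have hd : 0 < d := by positivity
  obtain ⟨C, hC, h_bound⟩ := h_fixed (d / 2) d (half_pos hd) (half_lt_self hd)
    ⟨_, Deconvolution.fejerMixture_mem_supersmoothWith ha⟩
  exact ⟨C, hC, fun n m hn hm => (h_bound n m hn hm).trans <|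
    Deconvolution.minimaxRisk_mono n m s _ fun ε hε => ⟨d / 2, half_pos hd, hε⟩⟩
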